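/- Let $\ell>0$, $T>0$, and let $\rho,\sigma\in H^2(0,\ell)$, $q\in H^1(0,\ell)$ be real functions such that, for some constants $\rho_0,\sigma_0>0$, $\rho\ge\rho_0$, $\sigma\ge\sigma_0$ and $q\ge 0$ on $[0,\ell]$. Let $L^2_\rho(0,\ell)$ be the Hilbert space of complex-valued functions that are square integrable with respect to $\rho(x)\,dx$, and let $\mathcal A$ be the operator in $L^2_\rho(0,\ell)$ given by $$\mathcal A y=\rho^{-1}\big((\sigma y'')''-(qy')'\big),\qquad \mathcal D(\mathcal A)=\{y\in H^4(0,\ell): y(0)=y'(0)=y(\ell)=y'(\ell)=0\}.$$ Then $L^2_\rho(0,\ell)$ has an orthonormal basis $(\Phi_n)_{n\ge1}$ of eigenfunctions of $\mathcal A$, $\mathcal A\Phi_n=\lambda_n\Phi_n$, with $0<\lambda_1\le\lambda_2\le\dots\to+\infty$. For $\theta\in\mathbb R$ let $\mathcal A^\theta$ be the power of $\mathcal A$ defined by its spectral decomposition (i.e. $\mathcal A^\theta u=\sum_r r^\theta P_r u$, where $P_r$ is the orthogonal projection onto $\ker(\mathcal A-r)$, on the domain of all $u$ for which the series converges), and let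 $\mathcal H_\theta$ be $\mathcal D(\mathcal A^\theta)$ with the norm $\|u\|_\theta=\|\mathcal A^\theta u\|_{L^2_\rho(0,\ell)}$ if $\theta\ge0$, and the completion of $L^2_\rho(0,\ell)$ for this norm if $\theta<0$. For $\varphi\in\mathcal D(\mathcal A^\infty)=\bigcap_k\mathcal D(\mathcal A^k)$ let $\langle\cdot,\varphi\rangle$ denote the continuous extension to $\mathcal H_\theta$ of the inner product of $L^2_\rho(0,\ell)$. Let $\theta\in\mathbb R$ and $y^0\in\mathcal H_\theta$. Then the clamped problem $$\begin{cases} i\rho\,\partial_t y=-\partial_x^2(\sigma\,\partial_x^2y)+\partial_x(q\,\partial_xy), & (t,x)\in(0,T)\times(0,\ell),\\ y(t,0)=\partial_xy(t,0)=y(t,\ell)=\partial_xy(t,\ell)=0,& t\in(0,T),\\ y(0,\cdot)=y^0\end{cases}$$ has a unique solution $y\in C([0,T];\mathcal H_\theta)$. Here a solution is a function $y\in C([0,T];\mathcal H_\theta)$ with $y(0)=y^0$ such that, for all $\varphi\in\mathcal D(\mathcal A^\infty)$, the function $t\mapsto\langle y(t),\varphi\rangle$ is differentiable on $(0,T)$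 with $\frac{d}{dt}\langle y(t),\varphi\rangle=i\langle y(t),\mathcal A\varphi\rangle$. For every orthonormal basis $(\Phi_n)$ of eigenfunctions of $\mathcal A$ with nondecreasing sequence of eigenvalues $(\lambda_n)$, one has $\Phi_n\in\mathcal D(\mathcal A^\theta)$ for all $n$, the initial datum can be written as $y^0=\sum_n c_n\Phi_n$ with $c_n\in\mathbb C$ (convergence in $\mathcal H_\theta$), and for any such $(c_n)$ and all $t\in[0,T]$ $$y(t)=\sum_{n} c_n e^{i\lambda_n t}\,\Phi_n\qquad\text{in }\mathcal H_\theta .$$ Moreover the energy is conserved: $\|y(t)\|_\theta^2=\|y^0\|_\theta^2$ for all $t\in[0,T]$. -/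

import Mathlib

open MeasureTheory

noncomputable section

/-! ### Sobolev spaces on `(0, ℓ)` -/

/-- `f` is absolutely continuous on `[0, ℓ]` with (weak, a.e.) derivative `g ∈ L¹(0, ℓ)`. -/
def HasACDeriv {E : Type*} [NormedAddCommGroup E] [NormedSpace ℝ E] (ℓ : ℝ) (f g : ℝ → E) : Prop :=
  IntegrableOn g (Set.Ioo 0 ℓ) ∧ ∀ x ∈ Set.Icc 0 ℓ, f x = f 0 + ∫ t in (0 : ℝ)..x, g t

/-- `D 0, …, D k` are a function in `H^k(0, ℓ)` and its derivatives of order `1, …, k`. For `j < k`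
the function `D j` is the continuous representative on `[0, ℓ]`. -/
def IsSobolevJet {E : Type*} [NormedAddCommGroup E] [NormedSpace ℝ E] (ℓ : ℝ) (k : ℕ)
    (D : ℕ → ℝ → E) : Prop :=
  (∀ j < k, HasACDeriv ℓ (D j) (D (j + 1))) ∧
    ∀ j ≤ k, MemLp (D j) 2 (volume.restrict (Set.Ioo 0 ℓ))

/-- `f ∈ H^k(0, ℓ)` (for `k ≥ 1`: `f` is the continuous representative on `[0, ℓ]`). -/
def MemSobolev {E : Type*} [NormedAddCommGroup E] [NormedSpace ℝ E] (ℓ : ℝ) (k : ℕ)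
    (f : ℝ → E) : Prop :=
  ∃ D : ℕ → ℝ → E, D 0 = f ∧ IsSobolevJet ℓ k D

section SobolevLemmas

variable {E : Type*} [NormedAddCommGroup E] [NormedSpace ℝ E] {ℓ : ℝ}

theorem HasACDeriv.add {f g f' g' : ℝ → E} (h : HasACDeriv ℓ f g) (h' : HasACDeriv ℓ f' g') :
    HasACDeriv ℓ (f + f') (g + g') := by
  refine ⟨h.1.add h'.1, fun x hx => ?_⟩
  have key : ∀ k : ℝ → E, IntegrableOn k (Set.Ioo 0 ℓ) → IntervalIntegrable k volume 0 x := by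
    intro k hk
    rw [intervalIntegrable_iff_integrableOn_Ioo_of_le hx.1]
    exact hk.mono_set (Set.Ioo_subset_Ioo_right hx.2)
  have := intervalIntegral.integral_add (key g h.1) (key g' h'.1)
  simp only [Pi.add_apply]
  rw [this, h.2 x hx, h'.2 x hx]
  abel

theorem HasACDeriv.const_smul {f g : ℝ → ℂ} (c : ℂ) (h : HasACDeriv ℓ f g) :
    HasACDeriv ℓ (c • f) (c • g) := by
  refine ⟨h.1.smul c, fun x hx => ?_⟩
  have := intervalIntegral.integral_smul (a := 0) (b := x) (μ := volume) c g
  simp only [Pi.smul_apply]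
  rw [this, h.2 x hx, smul_add]

theorem IsSobolevJet.add {k : ℕ} {D D' : ℕ → ℝ → E} (h : IsSobolevJet ℓ k D)
    (h' : IsSobolevJet ℓ k D') : IsSobolevJet ℓ k (D + D') :=
  ⟨fun j hj => (h.1 j hj).add (h'.1 j hj), fun j hj => (h.2 j hj).add (h'.2 j hj)⟩

theorem IsSobolevJet.const_smul {k : ℕ} {D : ℕ → ℝ → ℂ} (c : ℂ) (h : IsSobolevJet ℓ k D) :
    IsSobolevJet ℓ k (c • D) :=
  ⟨fun j hj => (h.1 j hj).const_smul c, fun j hj => (h.2 j hj).const_smul c⟩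

end SobolevLemmas

/-! ### The clamped operator on `L²_ρ(0, ℓ)` -/

/-- The measure `ρ(x) dx` on `(0, ℓ)`. -/
def weightMeasure (ℓ : ℝ) (ρ : ℝ → ℝ) : Measure ℝ :=
  (volume.restrict (Set.Ioo 0 ℓ)).withDensity fun x => ENNReal.ofReal (ρ x)

/-- The Hilbert space `L²_ρ(0, ℓ)` of complex-valued functions. -/
abbrev WeightedL2 (ℓ : ℝ) (ρ : ℝ → ℝ) : Type := Lp ℂ 2 (weightMeasure ℓ ρ)

/-- The pairs `(y, v)` with `y ∈ H⁴(0, ℓ)`, `y(0) = y'(0) = y(ℓ) = y'(ℓ) = 0` and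
`v = ρ⁻¹ ((σ y'')'' - (q y')')`. Here `Y`, `W`, `Q` list the derivatives of `y`, of `σ y''`
and of `q y'`. -/
def clampedGraph (ℓ : ℝ) (ρ σ q : ℝ → ℝ) :
    Submodule ℂ (WeightedL2 ℓ ρ × WeightedL2 ℓ ρ) where
  carrier := {p | ∃ Y W Q : ℕ → ℝ → ℂ,
    IsSobolevJet ℓ 4 Y ∧
    (Y 0 0 = 0 ∧ Y 1 0 = 0 ∧ Y 0 ℓ = 0 ∧ Y 1 ℓ = 0) ∧
    (IsSobolevJet ℓ 2 W ∧ ∀ x, W 0 x = (σ x : ℂ) * Y 2 x) ∧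
    (IsSobolevJet ℓ 1 Q ∧ ∀ x, Q 0 x = (q x : ℂ) * Y 1 x) ∧
    (p.1 : ℝ → ℂ) =ᵐ[weightMeasure ℓ ρ] Y 0 ∧
    (p.2 : ℝ → ℂ) =ᵐ[weightMeasure ℓ ρ] fun x => (ρ x : ℂ)⁻¹ * (W 2 x - Q 1 x)}
  zero_mem' := by
    have hz : ∀ k, IsSobolevJet ℓ k (0 : ℕ → ℝ → ℂ) := fun k =>
      ⟨fun j _ => ⟨integrableOn_zero, fun x _ => by simp⟩, fun j _ => MemLp.zero⟩
    refine ⟨0, 0, 0, hz 4, by simp, ⟨hz 2, by simp⟩, ⟨hz 1, by simp⟩, ?_, ?_⟩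
    · exact Lp.coeFn_zero _ _ _
    · filter_upwards [Lp.coeFn_zero ℂ 2 (weightMeasure ℓ ρ)] with x hx
      simpa using hx
  add_mem' := by
    rintro p p' ⟨Y, W, Q, hY, hb, hW, hQ, h1, h2⟩ ⟨Y', W', Q', hY', hb', hW', hQ', h1', h2'⟩
    refine ⟨Y + Y', W + W', Q + Q', hY.add hY', ?_, ⟨hW.1.add hW'.1, fun x => ?_⟩,
      ⟨hQ.1.add hQ'.1, fun x => ?_⟩, ?_, ?_⟩
    · simp [hb.1, hb.2.1, hb.2.2.1, hb.2.2.2, hb'.1, hb'.2.1, hb'.2.2.1, hb'.2.2.2]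
    · simp only [Pi.add_apply, hW.2, hW'.2]; ring
    · simp only [Pi.add_apply, hQ.2, hQ'.2]; ring
    · filter_upwards [Lp.coeFn_add p.1 p'.1, h1, h1'] with x hx h h'
      simp only [Prod.fst_add, hx, Pi.add_apply, h, h']
    · filter_upwards [Lp.coeFn_add p.2 p'.2, h2, h2'] with x hx h h'
      simp only [Prod.snd_add, hx, Pi.add_apply, h, h']; ring
  smul_mem' := by
    rintro c p ⟨Y, W, Q, hY, hb, hW, hQ, h1, h2⟩
    refine ⟨c • Y, c • W, c • Q, hY.const_smul c, ?_, ⟨hW.1.const_smul c, fun x => ?_⟩,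
      ⟨hQ.1.const_smul c, fun x => ?_⟩, ?_, ?_⟩
    · simp [hb.1, hb.2.1, hb.2.2.1, hb.2.2.2]
    · simp only [Pi.smul_apply, smul_eq_mul, hW.2]; ring
    · simp only [Pi.smul_apply, smul_eq_mul, hQ.2]; ring
    · filter_upwards [Lp.coeFn_smul c p.1, h1] with x hx h
      simp only [Prod.smul_fst, hx, Pi.smul_apply, h]
    · filter_upwards [Lp.coeFn_smul c p.2, h2] with x hx h
      simp only [Prod.smul_snd, hx, Pi.smul_apply, h, smul_eq_mul]; ring

/-- The operator `𝒜 y = ρ⁻¹ ((σ y'')'' - (q y')')` in `L²_ρ(0, ℓ)` with domain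
`H⁴(0, ℓ) ∩ H²₀(0, ℓ)`. -/
def clampedOperator (ℓ : ℝ) (ρ σ q : ℝ → ℝ) : WeightedL2 ℓ ρ →ₗ.[ℂ] WeightedL2 ℓ ρ :=
  (clampedGraph ℓ ρ σ q).toLinearPMap

/-! ### Real powers and the scale of spaces generated by an operator

The definitions below are meant for a positive self-adjoint operator `A` that has an orthonormal
basis of eigenvectors. -/

section Scale

variable {H : Type*} [NormedAddCommGroup H] [InnerProductSpace ℂ H]

/-- The eigenspace `ker (A - r)`. -/
def eigSpace (A : H →ₗ.[ℂ] H) (r : ℝ) : Submodule ℂ H where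
  carrier := {u | ∃ h : u ∈ A.domain, A ⟨u, h⟩ = (r : ℂ) • u}
  zero_mem' := ⟨A.domain.zero_mem, by
    have : (⟨0, A.domain.zero_mem⟩ : A.domain) = 0 := rfl
    rw [this, LinearPMap.map_zero, smul_zero]⟩
  add_mem' := by
    rintro u v ⟨hu, hu'⟩ ⟨hv, hv'⟩
    refine ⟨A.domain.add_mem hu hv, ?_⟩
    have : (⟨u + v, A.domain.add_mem hu hv⟩ : A.domain) = ⟨u, hu⟩ + ⟨v, hv⟩ := rfl
    rw [this, LinearPMap.map_add, hu', hv', smul_add]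
  smul_mem' := by
    rintro c u ⟨hu, hu'⟩
    refine ⟨A.domain.smul_mem c hu, ?_⟩
    have : (⟨c • u, A.domain.smul_mem c hu⟩ : A.domain) = c • ⟨u, hu⟩ := rfl
    rw [this, LinearPMap.map_smul, hu', smul_comm]

/-- `D(A^∞)`, the intersection of the domains of the iterates of `A`: the vectors `φ` for which
`φ, Aφ, A²φ, …` are all defined. -/
def smoothVectors (A : H →ₗ.[ℂ] H) : Set H :=
  {φ | ∃ f : ℕ → H, f 0 = φ ∧ ∀ k, ∃ h : f k ∈ A.domain, A ⟨f k, h⟩ = f (k + 1)}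

theorem smoothVectors_subset_domain (A : H →ₗ.[ℂ] H) {φ : H} (hφ : φ ∈ smoothVectors A) :
    φ ∈ A.domain := by
  obtain ⟨f, rfl, hf⟩ := hφ
  exact (hf 0).1

variable [CompleteSpace H]

/-- The orthogonal projection onto the (closure of the) eigenspace `ker (A - r)`. -/
def eigProj (A : H →ₗ.[ℂ] H) (r : ℝ) : H →L[ℂ] H :=
  (eigSpace A r).topologicalClosure.starProjection

/-- The power `A^θ u = ∑_r r^θ P_r u`, the sum being over the eigenvalues `r` of `A` (`P_r = 0` for
all other `r`), on the domain of all `u` for which this series converges in `H`. -/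
def opPow (A : H →ₗ.[ℂ] H) (θ : ℝ) : H →ₗ.[ℂ] H where
  domain :=
    { carrier := {u | Summable fun r : ℝ => ((r ^ θ : ℝ) : ℂ) • eigProj A r u}
      zero_mem' := by simp [summable_zero]
      add_mem' := fun {u v} hu hv => by
        simpa only [Set.mem_ofPred_eq, map_add, smul_add] using hu.add hv
      smul_mem' := fun c u hu => by
        have := Summable.const_smul c hu
        simpa only [Set.mem_ofPred_eq, map_smul, smul_comm c] using this }
  toFun :=
    { toFun := fun u => ∑' r : ℝ, ((r ^ θ : ℝ) : ℂ) • eigProj A r (u : H)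
      map_add' := fun u v => by
        have := u.2.tsum_add v.2
        simpa only [Submodule.coe_add, map_add, smul_add] using this
      map_smul' := fun c u => by
        have := u.2.tsum_const_smul c
        simpa only [Submodule.coe_smul, map_smul, smul_comm c, RingHom.id_apply] using this }

/-- The domain of `A^θ`, to be equipped with the norm `‖A^θ u‖`. -/
def PreScale (A : H →ₗ.[ℂ] H) (θ : ℝ) : Type _ := ↥(opPow A θ).domain

instance (A : H →ₗ.[ℂ] H) (θ : ℝ) : AddCommGroup (PreScale A θ) :=
  inferInstanceAs (AddCommGroup ↥(opPow A θ).domain)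

instance (A : H →ₗ.[ℂ] H) (θ : ℝ) : Module ℂ (PreScale A θ) :=
  inferInstanceAs (Module ℂ ↥(opPow A θ).domain)

/-- `u ↦ A^θ u` on `D(A^θ)`. -/
def PreScale.pow (A : H →ₗ.[ℂ] H) (θ : ℝ) : PreScale A θ →ₗ[ℂ] H := (opPow A θ).toFun

instance (A : H →ₗ.[ℂ] H) (θ : ℝ) : SeminormedAddCommGroup (PreScale A θ) :=
  SeminormedAddCommGroup.induced _ _ (PreScale.pow A θ)

instance (A : H →ₗ.[ℂ] H) (θ : ℝ) : NormedSpace ℂ (PreScale A θ) :=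
  NormedSpace.induced ℂ _ _ (PreScale.pow A θ)

/-- The space `𝓗_θ`: the completion of `D(A^θ)` for the norm `‖A^θ u‖`. If `A` is positive
self-adjoint with a bounded inverse, then `D(A^θ)` is already complete for `θ ≥ 0`, so that `𝓗_θ`
is `D(A^θ)`, while `D(A^θ) = H` for `θ < 0`, so that `𝓗_θ` is the completion of `H`. -/
abbrev Scale (A : H →ₗ.[ℂ] H) (θ : ℝ) : Type _ := UniformSpace.Completion (PreScale A θ)

/-- An element of `D(A^θ) ⊆ H` as an element of `𝓗_θ`. -/
def toScale (A : H →ₗ.[ℂ] H) (θ : ℝ) (u : H) (hu : u ∈ (opPow A θ).domain) : Scale A θ :=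
  ((show PreScale A θ from ⟨u, hu⟩) : Scale A θ)

/-- The duality pairing of `u ∈ 𝓗_θ` with `φ ∈ D(A^∞)` (conjugate-linear in `φ`): the continuous
extension to `𝓗_θ` of the inner product `u ↦ ⟪φ, u⟫` of `H`. -/
def scalePairing (A : H →ₗ.[ℂ] H) (θ : ℝ) (φ : H) : Scale A θ → ℂ :=
  UniformSpace.Completion.extension fun u : PreScale A θ =>
    inner ℂ φ ((show ↥(opPow A θ).domain from u) : H)

/-- `y ∈ C([0, T]; 𝓗_θ)` is a (weak) solution of `i y_t = -A y` on `(0, T)` with `y(0) = y⁰`: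
for all `φ ∈ D(A^∞)` one has `d/dt ⟨y(t), φ⟩ = i ⟨y(t), A φ⟩` on `(0, T)`. -/
def IsSchrodingerSolution (A : H →ₗ.[ℂ] H) (θ : ℝ) {T : ℝ} (hT : 0 < T) (y₀ : Scale A θ)
    (y : C(Set.Icc (0 : ℝ) T, Scale A θ)) : Prop :=
  y ⟨0, Set.left_mem_Icc.mpr hT.le⟩ = y₀ ∧
  ∀ φ (hφ : φ ∈ smoothVectors A), ∀ t ∈ Set.Ioo (0 : ℝ) T,
    HasDerivAt (fun s => scalePairing A θ φ (y (Set.projIcc 0 T hT.le s)))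
      (Complex.I * scalePairing A θ (A ⟨φ, smoothVectors_subset_domain A hφ⟩)
        (y (Set.projIcc 0 T hT.le t))) t

/-- `Φ` is an orthonormal basis of `H` made of eigenvectors of `A`, with the nondecreasing sequence
of eigenvalues `lam`. -/
def IsEigenbasis (A : H →ₗ.[ℂ] H) (lam : ℕ → ℝ) (Φ : HilbertBasis ℕ ℂ H) : Prop :=
  Monotone lam ∧ ∀ n, Φ n ∈ eigSpace A (lam n)

end Scale

end

noncomputable section

/-! ### Calculus of absolutely continuous functions on `[0, ℓ]` -/

section ACCalculus

variable {ℓ : ℝ}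

/-! The operator `𝒜` is understood through its inverse, and the evolution through Fourier
coefficients.

Take `w = y''` as the unknown and let `J` be the Volterra operator on `L²(0, ℓ)`. Then `y = J² w`,
the conditions at `0` are automatic, and those at `ℓ` say that `w` is orthogonal to the affine
functions. On this closed subspace the form `∫ σ w η̄ + ∫ q (J w) (J η)⁻` is coercive because `σ ≥
σ₀` and `q ≥ 0`, so the weak problem with datum `f` has a solution `w`, and `K f = J² w` is compact
(Arzelà–Ascoli), symmetric and nonnegative (`exists_compact_solution_operator`).

Regularity comes from `J* = ⟨1, ·⟩ 1 - J`: the weak equation becomes `σ w = affine + J (q J w) + J²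
(ρ f)`, hence `σ w ∈ H²`, and dividing by `σ` gives `y ∈ H⁴` (`mem_clampedGraph_of_weak`). Since `𝒜`
has trivial kernel by the energy identity, its graph is exactly the transposed graph of `K`
(`exists_inverse_clampedOperator`). The spectral theorem for `K` yields the eigenbasis.

For the evolution, `𝒜^θ` extends to a unitary map of `𝓗_θ` onto `L²_ρ` (`scaleIsometry`,
`scaleIsometry_surjective`), and `⟨·, φ⟩` becomes the inner product with `𝒜^(-θ) φ`
(`scalePairing_eq_inner`). Testing the equation with `Φ n` gives a scalar linear ODE, so the `n`-th
coefficient is multiplied by `e^{i λ_n t}` (`IsSchrodingerSolution.inner_eq`). Uniqueness, the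
series and, by Parseval, the energy identity follow. Conversely these coefficients define a
continuous orbit, and termwise differentiation shows that it is a solution. -/

theorem intervalIntegrable_of_integrableOn_Ioo {E : Type*} [NormedAddCommGroup E] {g : ℝ → E}
    {a b ℓ : ℝ} (hg : IntegrableOn g (Set.Ioo 0 ℓ)) (ha : a ∈ Set.Icc 0 ℓ) (hb : b ∈ Set.Icc 0 ℓ) :
    IntervalIntegrable g volume a b := by
  have hℓ : (0 : ℝ) ≤ ℓ := ha.1.trans ha.2
  have h : IntervalIntegrable g volume 0 ℓ :=
    (intervalIntegrable_iff_integrableOn_Ioo_of_le hℓ).2 hg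
  refine h.mono_set ?_
  rw [Set.uIcc_of_le hℓ]
  exact Set.uIcc_subset_Icc ha hb

theorem intervalIntegral_congr_ae_Ioo {E : Type*} [NormedAddCommGroup E] [NormedSpace ℝ E]
    {g g' : ℝ → E} (hg : g =ᵐ[volume.restrict (Set.Ioo 0 ℓ)] g') {x : ℝ} (hx : x ∈ Set.Icc 0 ℓ) :
    ∫ t in (0 : ℝ)..x, g t = ∫ t in (0 : ℝ)..x, g' t := by
  rw [intervalIntegral.integral_of_le hx.1, intervalIntegral.integral_of_le hx.1,
    integral_Ioc_eq_integral_Ioo, integral_Ioc_eq_integral_Ioo]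
  exact integral_congr_ae (ae_restrict_of_ae_restrict_of_subset (Set.Ioo_subset_Ioo_right hx.2) hg)

theorem AbsolutelyContinuousOnInterval.ofReal {f : ℝ → ℝ} {a b : ℝ}
    (hf : AbsolutelyContinuousOnInterval f a b) :
    AbsolutelyContinuousOnInterval (fun x => (f x : ℂ)) a b := by
  unfold AbsolutelyContinuousOnInterval at hf ⊢
  simpa only [Complex.isometry_ofReal.dist_eq] using hf

theorem AbsolutelyContinuousOnInterval.congr_of_eqOn {X : Type*} [PseudoMetricSpace X] {f g : ℝ → X}
    {a b : ℝ} (hf : AbsolutelyContinuousOnInterval f a b) (h : Set.EqOn g f (Set.uIcc a b)) :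
    AbsolutelyContinuousOnInterval g a b := by
  rw [absolutelyContinuousOnInterval_iff] at hf ⊢
  intro ε hε
  obtain ⟨δ, hδ, H⟩ := hf ε hε
  refine ⟨δ, hδ, fun E hE hE' => ?_⟩
  refine (Finset.sum_congr rfl fun i hi => ?_).trans_lt (H E hE hE')
  rw [h (hE.1 i hi).1, h (hE.1 i hi).2]

theorem IntervalIntegrable.absolutelyContinuousOnInterval_complex {g : ℝ → ℂ} {a b : ℝ}
    (hg : IntervalIntegrable g volume a b) :
    AbsolutelyContinuousOnInterval (fun x => ∫ t in a..x, g t) a b := by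
  have hre : IntervalIntegrable (fun t => (g t).re) volume a b := ⟨hg.1.re, hg.2.re⟩
  have him : IntervalIntegrable (fun t => (g t).im) volume a b := ⟨hg.1.im, hg.2.im⟩
  have h1 := (hre.absolutelyContinuousOnInterval_intervalIntegral (c := a) (by simp)).ofReal
  have h2 := (him.absolutelyContinuousOnInterval_intervalIntegral (c := a) (by simp)).ofReal
  refine (h1.add (h2.const_smul Complex.I)).congr_of_eqOn fun x hx => ?_
  have hs : Set.uIcc a x ⊆ Set.uIcc a b := Set.uIcc_subset_uIcc_left hx
  simp only [Pi.add_apply, ← intervalIntegral.integral_ofReal, smul_eq_mul,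
    ← intervalIntegral.integral_const_mul]
  rw [← intervalIntegral.integral_add]
  · congr 1
    ext t
    rw [mul_comm, Complex.re_add_im]
  · exact ⟨(hre.mono_set hs).1.ofReal, (hre.mono_set hs).2.ofReal⟩
  · exact ⟨(him.mono_set hs).1.ofReal.const_mul _, (him.mono_set hs).2.ofReal.const_mul _⟩

theorem HasACDeriv.congr {f f' g g' : ℝ → ℂ} (h : HasACDeriv ℓ f g) (hℓ : 0 ≤ ℓ)
    (hf : Set.EqOn f' f (Set.Icc 0 ℓ)) (hg : g' =ᵐ[volume.restrict (Set.Ioo 0 ℓ)] g) :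
    HasACDeriv ℓ f' g' := by
  refine ⟨Integrable.congr h.1 hg.symm, fun x hx => ?_⟩
  rw [hf hx, hf ⟨le_rfl, hℓ⟩, h.2 x hx, intervalIntegral_congr_ae_Ioo hg hx]

theorem HasACDeriv.absolutelyContinuousOnInterval {f g : ℝ → ℂ} (h : HasACDeriv ℓ f g)
    (hℓ : 0 ≤ ℓ) : AbsolutelyContinuousOnInterval f 0 ℓ := by
  have h1 := (intervalIntegrable_of_integrableOn_Ioo h.1 ⟨le_rfl, hℓ⟩
    ⟨hℓ, le_rfl⟩).absolutelyContinuousOnInterval_complex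
  have h2 : AbsolutelyContinuousOnInterval (fun _ : ℝ => f 0) 0 ℓ := by
    simp [AbsolutelyContinuousOnInterval, tendsto_const_nhds]
  refine (h2.add h1).congr_of_eqOn fun x hx => ?_
  rw [Set.uIcc_of_le hℓ] at hx
  exact h.2 x hx

theorem HasACDeriv.continuousOn {f g : ℝ → ℂ} (h : HasACDeriv ℓ f g) (hℓ : 0 ≤ ℓ) :
    ContinuousOn f (Set.Icc 0 ℓ) := by
  have := (h.absolutelyContinuousOnInterval hℓ).continuousOn
  rwa [Set.uIcc_of_le hℓ] at this

theorem HasACDeriv.ae_hasDerivAt {f g : ℝ → ℂ} (h : HasACDeriv ℓ f g) (hℓ : 0 ≤ ℓ) :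
    ∀ᵐ x, x ∈ Set.Ioo 0 ℓ → HasDerivAt f (g x) x := by
  filter_upwards [(intervalIntegrable_of_integrableOn_Ioo h.1 ⟨le_rfl, hℓ⟩
    ⟨hℓ, le_rfl⟩).ae_hasDerivAt_integral] with x hx hx'
  have h1 := (hx (by rw [Set.uIcc_of_le hℓ]; exact Set.Ioo_subset_Icc_self hx') 0
    (by simp)).const_add (f 0)
  refine h1.congr_of_eventuallyEq ?_
  filter_upwards [Ioo_mem_nhds hx'.1 hx'.2] with y hy
  exact h.2 y (Set.Ioo_subset_Icc_self hy)

theorem ae_mem_Ioo_of_mem_Icc (a b : ℝ) : ∀ᵐ x : ℝ, x ∈ Set.Icc a b → x ∈ Set.Ioo a b := by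
  have h₁ : ∀ᵐ x : ℝ, x ≠ a := by simp [ae_iff, measure_singleton]
  have h₂ : ∀ᵐ x : ℝ, x ≠ b := by simp [ae_iff, measure_singleton]
  filter_upwards [h₁, h₂] with x h1 h2 h
  exact ⟨lt_of_le_of_ne h.1 h1.symm, lt_of_le_of_ne h.2 h2⟩

/-- The difference of `f` and the primitive of `g` is absolutely continuous with zero derivative
almost everywhere, hence constant. This reduces the product rule to a pointwise computation almost
everywhere. -/
theorem hasACDeriv_of_absolutelyContinuousOnInterval {f g : ℝ → ℂ}
    (hf : AbsolutelyContinuousOnInterval f 0 ℓ) (hg : IntegrableOn g (Set.Ioo 0 ℓ))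
    (hfg : ∀ᵐ x, x ∈ Set.Ioo 0 ℓ → HasDerivAt f (g x) x) (hℓ : 0 ≤ ℓ) : HasACDeriv ℓ f g := by
  refine ⟨hg, fun x hx => ?_⟩
  have hgi := intervalIntegrable_of_integrableOn_Ioo hg ⟨le_rfl, hℓ⟩ ⟨hℓ, le_rfl⟩
  have hac := hf.sub hgi.absolutelyContinuousOnInterval_complex
  obtain ⟨C, hC⟩ := hac.const_of_ae_hasDerivAt_zero (by
    filter_upwards [hfg, hgi.ae_hasDerivAt_integral, ae_mem_Ioo_of_mem_Icc 0 ℓ] with y h1 h2 h3 hy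
    have h4 := (h1 (h3 (by rwa [Set.uIcc_of_le hℓ] at hy))).sub (h2 hy 0 (by simp))
    simpa using h4)
  rw [Set.uIcc_of_le hℓ] at hC
  have e1 := hC x hx
  have e2 := hC 0 ⟨le_rfl, hℓ⟩
  simp only [Pi.sub_apply, intervalIntegral.integral_same, sub_zero] at e1 e2
  rw [e2, ← e1]
  ring

theorem MeasureTheory.IntegrableOn.continuousOn_mul_Ioo {f g : ℝ → ℂ}
    (hg : IntegrableOn g (Set.Ioo 0 ℓ)) (hf : ContinuousOn f (Set.Icc 0 ℓ)) :
    IntegrableOn (fun x => f x * g x) (Set.Ioo 0 ℓ) := by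
  rw [← integrableOn_Icc_iff_integrableOn_Ioo] at hg ⊢
  exact hg.continuousOn_mul hf isCompact_Icc

theorem HasACDeriv.mul {f g f' g' : ℝ → ℂ} (h : HasACDeriv ℓ f g) (h' : HasACDeriv ℓ f' g')
    (hℓ : 0 ≤ ℓ) :
    HasACDeriv ℓ (fun x => f x * f' x) (fun x => g x * f' x + f x * g' x) := by
  refine hasACDeriv_of_absolutelyContinuousOnInterval ?_ ?_ ?_ hℓ
  · exact (h.absolutelyContinuousOnInterval hℓ).smul (h'.absolutelyContinuousOnInterval hℓ)
  · refine Integrable.add ?_ (h'.1.continuousOn_mul_Ioo (h.continuousOn hℓ))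
    have := h.1.continuousOn_mul_Ioo (h'.continuousOn hℓ)
    exact this.congr (.of_forall fun x => mul_comm _ _)
  · filter_upwards [h.ae_hasDerivAt hℓ, h'.ae_hasDerivAt hℓ] with x h1 h2 hx
    exact (h1 hx).mul (h2 hx)

theorem HasACDeriv.ofReal {f g : ℝ → ℝ} (h : HasACDeriv ℓ f g) :
    HasACDeriv ℓ (fun x => (f x : ℂ)) (fun x => (g x : ℂ)) := by
  refine ⟨h.1.ofReal, fun x hx => ?_⟩
  beta_reduce
  rw [h.2 x hx, intervalIntegral.integral_ofReal, Complex.ofReal_add]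

theorem hasACDeriv_integral {g : ℝ → ℂ} (c : ℂ) (hg : IntegrableOn g (Set.Ioo 0 ℓ)) :
    HasACDeriv ℓ (fun x => c + ∫ t in (0 : ℝ)..x, g t) g :=
  ⟨hg, fun x _ => by simp⟩

theorem HasACDeriv.hasDerivAt_of_continuousOn {f g : ℝ → ℂ} (h : HasACDeriv ℓ f g)
    (hg : ContinuousOn g (Set.Icc 0 ℓ)) {x : ℝ} (hx : x ∈ Set.Ioo 0 ℓ) : HasDerivAt f (g x) x := by
  have hx' := Set.Ioo_subset_Icc_self hx
  have hℓ : 0 ≤ ℓ := hx'.1.trans hx'.2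
  have hc : ContinuousOn g (Set.Ioo 0 ℓ) := hg.mono Set.Ioo_subset_Icc_self
  have h1 := (intervalIntegral.integral_hasDerivAt_right
    (intervalIntegrable_of_integrableOn_Ioo h.1 ⟨le_rfl, hℓ⟩ hx')
    (hc.stronglyMeasurableAtFilter isOpen_Ioo x hx)
    (hc.continuousAt (Ioo_mem_nhds hx.1 hx.2))).const_add (f 0)
  refine h1.congr_of_eventuallyEq ?_
  filter_upwards [Ioo_mem_nhds hx.1 hx.2] with y hy
  exact h.2 y (Set.Ioo_subset_Icc_self hy)

/-- Continuity of `g` makes `f` differentiable at every interior point, so the classical fundamental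
theorem applies to `1 / f`. It is needed for `1 / σ`. -/
theorem HasACDeriv.inv_of_continuousOn {f g : ℝ → ℂ} (h : HasACDeriv ℓ f g)
    (hg : ContinuousOn g (Set.Icc 0 ℓ)) (hℓ : 0 ≤ ℓ) (hf : ∀ x ∈ Set.Icc 0 ℓ, f x ≠ 0) :
    HasACDeriv ℓ (fun x => (f x)⁻¹) (fun x => -g x * ((f x)⁻¹ * (f x)⁻¹)) := by
  have hfc := (h.continuousOn hℓ).inv₀ hf
  have hc : ContinuousOn (fun x => -g x * ((f x)⁻¹ * (f x)⁻¹)) (Set.Icc 0 ℓ) :=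
    hg.neg.mul (hfc.mul hfc)
  refine ⟨(hc.integrableOn_Icc).mono_set Set.Ioo_subset_Icc_self, fun x hx => ?_⟩
  have hs : Set.Icc 0 x ⊆ Set.Icc 0 ℓ := Set.Icc_subset_Icc_right hx.2
  rw [intervalIntegral.integral_eq_sub_of_hasDerivAt_of_le hx.1 (hfc.mono hs) (fun y hy => ?_)
    (ContinuousOn.intervalIntegrable (by rw [Set.uIcc_of_le hx.1]; exact hc.mono hs))]
  · simp
  · have hy' : y ∈ Set.Ioo 0 ℓ := ⟨hy.1, hy.2.trans_le hx.2⟩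
    have hy0 := hf y (Set.Ioo_subset_Icc_self hy')
    exact ((h.hasDerivAt_of_continuousOn hg hy').inv hy0).congr_deriv
      (by rw [div_eq_mul_inv, sq, mul_inv])

/-- A continuous function vanishing almost everywhere on `(0, ℓ)` vanishes on `[0, ℓ]`. -/
theorem eqOn_zero_of_ae_eq_zero {f : ℝ → ℂ} (hf : ContinuousOn f (Set.Icc 0 ℓ)) (hℓ : 0 < ℓ)
    (h : f =ᵐ[volume.restrict (Set.Ioo 0 ℓ)] 0) : Set.EqOn f 0 (Set.Icc 0 ℓ) := by
  have h1 : f =ᵐ[volume.restrict (Set.Icc 0 ℓ)] 0 := by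
    rwa [restrict_Ioo_eq_restrict_Icc] at h
  exact Measure.eqOn_Icc_of_ae_eq volume hℓ.ne h1 hf continuousOn_const

theorem HasACDeriv.ae_eq_zero {f g : ℝ → ℂ} (h : HasACDeriv ℓ f g) (hℓ : 0 < ℓ)
    (hf : Set.EqOn f 0 (Set.Icc 0 ℓ)) : g =ᵐ[volume.restrict (Set.Ioo 0 ℓ)] 0 := by
  rw [Filter.EventuallyEq, ae_restrict_iff' measurableSet_Ioo]
  filter_upwards [h.ae_hasDerivAt hℓ.le] with x hx hx'
  refine (hx hx').unique ((hasDerivAt_const x (0 : ℂ)).congr_of_eventuallyEq ?_)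
  filter_upwards [Ioo_mem_nhds hx'.1 hx'.2] with y hy
  exact hf (Set.Ioo_subset_Icc_self hy)

end ACCalculus

/-! ### Volterra and multiplication operators on `L²(0, ℓ)` -/

section Operators

/-- The Lebesgue measure on `(0, ℓ)`. -/
abbrev intervalMeasure (ℓ : ℝ) : Measure ℝ := volume.restrict (Set.Ioo 0 ℓ)

/-- The space `L²(0, ℓ)` of complex-valued functions. -/
abbrev IntervalL2 (ℓ : ℝ) : Type := Lp ℂ 2 (intervalMeasure ℓ)

variable {ℓ : ℝ}

theorem MeasureTheory.MemLp.integrableOn_Ioo {E : Type*} [NormedAddCommGroup E] {f : ℝ → E}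
    (hf : MemLp f 2 (intervalMeasure ℓ)) :
    IntegrableOn f (Set.Ioo 0 ℓ) :=
  hf.integrable (by norm_num)

theorem IntervalL2.integrableOn (f : IntervalL2 ℓ) : IntegrableOn f (Set.Ioo 0 ℓ) :=
  (Lp.memLp f).integrableOn_Ioo

/-- Cauchy–Schwarz against the indicator of `(a, b)`. It makes primitives of `L²` functions Hölder
continuous of exponent `1/2`. -/
theorem IntervalL2.norm_integral_le (f : IntervalL2 ℓ) {a b : ℝ} (ha : 0 ≤ a) (hab : a ≤ b)
    (hb : b ≤ ℓ) : ‖∫ t in a..b, f t‖ ≤ √(b - a) * ‖f‖ := by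
  have hs : MeasurableSet (Set.Ioo a b) := measurableSet_Ioo
  have hμ : intervalMeasure ℓ (Set.Ioo a b) ≠ ⊤ := measure_ne_top _ _
  have hsub : Set.Ioo a b ⊆ Set.Ioo 0 ℓ := Set.Ioo_subset_Ioo ha hb
  have h1 : ∫ t in a..b, f t = inner ℂ (indicatorConstLp 2 hs hμ (1 : ℂ)) f := by
    rw [L2.inner_indicatorConstLp_one, Measure.restrict_restrict hs,
      Set.inter_eq_self_of_subset_left hsub, intervalIntegral.integral_of_le hab,
      integral_Ioc_eq_integral_Ioo]
  rw [h1]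
  refine (norm_inner_le_norm _ _).trans_eq ?_
  rw [norm_indicatorConstLp (by norm_num) (by norm_num), measureReal_restrict_apply hs,
    Set.inter_eq_self_of_subset_left hsub, Real.volume_real_Ioo_of_le hab, norm_one, one_mul,
    Real.sqrt_eq_rpow]
  norm_num

theorem IntervalL2.norm_integral_sub_le (hℓ : 0 ≤ ℓ) (f : IntervalL2 ℓ) {x y : ℝ}
    (hx : x ∈ Set.Icc 0 ℓ) (hy : y ∈ Set.Icc 0 ℓ) :
    ‖(∫ t in (0 : ℝ)..x, f t) - ∫ t in (0 : ℝ)..y, f t‖ ≤ √|x - y| * ‖f‖ := by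
  have h0 : (0 : ℝ) ∈ Set.Icc 0 ℓ := ⟨le_rfl, hℓ⟩
  have hi := f.integrableOn
  rw [intervalIntegral.integral_interval_sub_left
    (intervalIntegrable_of_integrableOn_Ioo hi h0 hx)
    (intervalIntegrable_of_integrableOn_Ioo hi h0 hy)]
  rcases le_total x y with h | h
  · rw [intervalIntegral.integral_symm, norm_neg, abs_sub_comm, abs_of_nonneg (sub_nonneg.2 h)]
    exact f.norm_integral_le hx.1 h hy.2
  · rw [abs_of_nonneg (sub_nonneg.2 h)]
    exact f.norm_integral_le hy.1 h hx.2

open scoped BoundedContinuousFunction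

theorem IntervalL2.continuous_integral (hℓ : 0 ≤ ℓ) (f : IntervalL2 ℓ) :
    Continuous fun x : Set.Icc (0 : ℝ) ℓ => ∫ t in (0 : ℝ)..x, f t := by
  have h := (hasACDeriv_integral 0 f.integrableOn).continuousOn hℓ
  simp only [zero_add] at h
  exact continuousOn_iff_continuous_domRestrict.1 h

/-- The operator `f ↦ ∫₀ˣ f` from `L²(0, ℓ)` to `C([0, ℓ])`. -/
def volterraCont (hℓ : 0 ≤ ℓ) : IntervalL2 ℓ →L[ℂ] (Set.Icc (0 : ℝ) ℓ →ᵇ ℂ) :=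
  LinearMap.mkContinuous
    { toFun := fun f => BoundedContinuousFunction.mkOfCompact
        ⟨fun x => ∫ t in (0 : ℝ)..x, f t, f.continuous_integral hℓ⟩
      map_add' := fun f g => by
        ext x
        have h0 : (0 : ℝ) ∈ Set.Icc 0 ℓ := ⟨le_rfl, hℓ⟩
        change ∫ t in (0 : ℝ)..x, (f + g : IntervalL2 ℓ) t =
          (∫ t in (0 : ℝ)..x, f t) + ∫ t in (0 : ℝ)..x, g t
        rw [intervalIntegral_congr_ae_Ioo (Lp.coeFn_add f g) x.2, ← intervalIntegral.integral_add
          (intervalIntegrable_of_integrableOn_Ioo f.integrableOn h0 x.2)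
          (intervalIntegrable_of_integrableOn_Ioo g.integrableOn h0 x.2)]
        rfl
      map_smul' := fun c f => by
        ext x
        change ∫ t in (0 : ℝ)..x, (c • f : IntervalL2 ℓ) t = c • ∫ t in (0 : ℝ)..x, f t
        rw [intervalIntegral_congr_ae_Ioo (Lp.coeFn_smul c f) x.2,
          ← intervalIntegral.integral_smul]
        rfl }
    (√ℓ) (fun f => by
      refine (BoundedContinuousFunction.norm_le (by positivity)).2 fun x => ?_
      refine (f.norm_integral_le le_rfl x.2.1 x.2.2).trans ?_
      gcongr
      linarith [x.2.2])

/-- Arzelà–Ascoli: the image of the unit ball is bounded and has the common modulus of continuity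
`√d`. -/
theorem isCompactOperator_volterraCont (hℓ : 0 ≤ ℓ) : IsCompactOperator (volterraCont hℓ) := by
  refine (isCompactOperator_iff_isCompact_closure_image_closedBall
    (volterraCont hℓ).toLinearMap one_pos).2 ?_
  refine BoundedContinuousFunction.arzela_ascoli (Metric.closedBall (0 : ℂ) (‖volterraCont hℓ‖))
    (isCompact_closedBall _ _) _ ?_ ?_
  · rintro _ x ⟨f, hf, rfl⟩
    rw [mem_closedBall_zero_iff] at hf ⊢
    refine (BoundedContinuousFunction.norm_coe_le_norm _ x).trans ?_
    refine ((volterraCont hℓ).le_opNorm f).trans ?_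
    exact mul_le_of_le_one_right (norm_nonneg _) hf
  · refine Metric.equicontinuous_of_continuity_modulus (fun d => √d) ?_ _ ?_
    · simpa using Real.continuous_sqrt.tendsto 0
    · rintro x y ⟨_, f, hf, rfl⟩
      rw [mem_closedBall_zero_iff] at hf
      rw [dist_eq_norm]
      refine (f.norm_integral_sub_le hℓ x.2 y.2).trans ?_
      exact mul_le_of_le_one_right (Real.sqrt_nonneg _) hf

/-- The embedding of `C([0, ℓ])` into `L²(μ)` for a finite measure `μ`. -/
def contToL2 (hℓ : 0 ≤ ℓ) (μ : Measure ℝ) [IsFiniteMeasure μ] :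
    (Set.Icc (0 : ℝ) ℓ →ᵇ ℂ) →L[ℂ] Lp ℂ 2 μ :=
  (BoundedContinuousFunction.toLp 2 μ ℂ).comp (LinearMap.mkContinuous (σ := RingHom.id ℂ)
    { toFun := fun f => f.compContinuous ⟨Set.projIcc 0 ℓ hℓ, continuous_projIcc⟩
      map_add' := fun f g => rfl
      map_smul' := fun c f => rfl } 1 (fun f => by
        rw [one_mul]
        exact (BoundedContinuousFunction.norm_le (norm_nonneg _)).2 fun x => f.norm_coe_le_norm _))

/-- The constant extension of `f` beyond `[0, ℓ]` is invisible to `μ`, which does not charge the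
complement of `(0, ℓ)`. -/
theorem coeFn_contToL2 (hℓ : 0 ≤ ℓ) {μ : Measure ℝ} [IsFiniteMeasure μ]
    (hμ : μ ≪ intervalMeasure ℓ) (f : Set.Icc (0 : ℝ) ℓ →ᵇ ℂ) {F : ℝ → ℂ}
    (hF : ∀ x : Set.Icc (0 : ℝ) ℓ, f x = F x) : contToL2 hℓ μ f =ᵐ[μ] F := by
  have h := BoundedContinuousFunction.coeFn_toLp (p := 2) (𝕜 := ℂ) μ
    (f.compContinuous ⟨Set.projIcc 0 ℓ hℓ, continuous_projIcc⟩)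
  have h2 : ∀ᵐ x ∂μ, x ∈ Set.Ioo 0 ℓ := hμ.ae_le (ae_restrict_mem measurableSet_Ioo)
  filter_upwards [h, h2] with x hx hx2
  refine hx.trans ?_
  have := hF ⟨x, Set.Ioo_subset_Icc_self hx2⟩
  rw [← this]
  simp [Set.projIcc_of_mem hℓ (Set.Ioo_subset_Icc_self hx2)]

/-- The Volterra operator `f ↦ ∫₀ˣ f` on `L²(0, ℓ)`. -/
def volterra (hℓ : 0 ≤ ℓ) : IntervalL2 ℓ →L[ℂ] IntervalL2 ℓ :=
  (contToL2 hℓ (intervalMeasure ℓ)).comp (volterraCont hℓ)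

theorem coeFn_volterra (hℓ : 0 ≤ ℓ) (f : IntervalL2 ℓ) :
    volterra hℓ f =ᵐ[intervalMeasure ℓ] fun x => ∫ t in (0 : ℝ)..x, f t :=
  coeFn_contToL2 hℓ Measure.AbsolutelyContinuous.rfl _ fun _ => rfl

theorem exists_ae_bound_of_continuousOn {m : ℝ → ℝ} (hm : ContinuousOn m (Set.Icc 0 ℓ)) :
    ∃ C, ∀ᵐ x ∂intervalMeasure ℓ, ‖(m x : ℂ)‖ ≤ C := by
  obtain ⟨C, hC⟩ := isCompact_Icc.exists_bound_of_continuousOn hm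
  refine ⟨C, ?_⟩
  filter_upwards [ae_restrict_mem measurableSet_Ioo] with x hx
  simpa using hC x (Set.Ioo_subset_Icc_self hx)

theorem aestronglyMeasurable_of_continuousOn_Icc {E : Type*} [TopologicalSpace E]
    [TopologicalSpace.PseudoMetrizableSpace E] [SecondCountableTopology E] {m : ℝ → E}
    (hm : ContinuousOn m (Set.Icc 0 ℓ)) : AEStronglyMeasurable m (intervalMeasure ℓ) :=
  (hm.mono Set.Ioo_subset_Icc_self).aestronglyMeasurable measurableSet_Ioo

theorem MeasureTheory.MemLp.continuousOn_mul {m f : ℝ → ℂ} (hf : MemLp f 2 (intervalMeasure ℓ))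
    (hm : ContinuousOn m (Set.Icc 0 ℓ)) : MemLp (fun x => m x * f x) 2 (intervalMeasure ℓ) := by
  obtain ⟨C, hC⟩ := isCompact_Icc.exists_bound_of_continuousOn hm
  refine hf.of_le_mul (c := C) ((aestronglyMeasurable_of_continuousOn_Icc hm).mul hf.1) ?_
  filter_upwards [ae_restrict_mem measurableSet_Ioo] with x hx
  rw [norm_mul]
  gcongr
  exact hC x (Set.Ioo_subset_Icc_self hx)

/-- Multiplication by a continuous real function on `L²(0, ℓ)`. -/
def mulOp {m : ℝ → ℝ} (hm : ContinuousOn m (Set.Icc 0 ℓ)) : IntervalL2 ℓ →L[ℂ] IntervalL2 ℓ :=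
  LinearMap.mkContinuous
    { toFun := fun f => ((Lp.memLp f).continuousOn_mul
        (Complex.continuous_ofReal.comp_continuousOn hm)).toLp
      map_add' := fun f g => by
        rw [← MemLp.toLp_add]
        refine MemLp.toLp_congr _ _ ?_
        filter_upwards [Lp.coeFn_add f g] with x hx
        simp only [hx, Pi.add_apply, mul_add]
      map_smul' := fun c f => by
        rw [RingHom.id_apply, ← MemLp.toLp_const_smul]
        refine MemLp.toLp_congr _ _ ?_
        filter_upwards [Lp.coeFn_smul c f] with x hx
        simp only [hx, Pi.smul_apply, smul_eq_mul]
        ring }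
    (exists_ae_bound_of_continuousOn hm).choose (fun f => by
      refine Lp.norm_le_mul_norm_of_ae_le_mul ?_
      filter_upwards [(exists_ae_bound_of_continuousOn hm).choose_spec, MemLp.coeFn_toLp
        ((Lp.memLp f).continuousOn_mul (Complex.continuous_ofReal.comp_continuousOn hm))]
        with x hx hx'
      refine (congrArg norm hx').trans_le ?_
      rw [norm_mul]
      gcongr
      exact hx)

theorem coeFn_mulOp {m : ℝ → ℝ} (hm : ContinuousOn m (Set.Icc 0 ℓ)) (f : IntervalL2 ℓ) :
    mulOp hm f =ᵐ[intervalMeasure ℓ] fun x => (m x : ℂ) * f x :=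
  MemLp.coeFn_toLp ((Lp.memLp f).continuousOn_mul (Complex.continuous_ofReal.comp_continuousOn hm))

theorem inner_mulOp_left {m : ℝ → ℝ} (hm : ContinuousOn m (Set.Icc 0 ℓ)) (f g : IntervalL2 ℓ) :
    inner ℂ (mulOp hm f) g = inner ℂ f (mulOp hm g) := by
  rw [L2.inner_def, L2.inner_def]
  refine integral_congr_ae ?_
  filter_upwards [coeFn_mulOp hm f, coeFn_mulOp hm g] with x h1 h2
  simp only [h1, h2, RCLike.inner_apply, map_mul, Complex.conj_ofReal]
  ring

theorem le_re_inner_mulOp {m : ℝ → ℝ} (hm : ContinuousOn m (Set.Icc 0 ℓ)) {c : ℝ}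
    (hc : ∀ x ∈ Set.Icc 0 ℓ, c ≤ m x) (f : IntervalL2 ℓ) :
    c * ‖f‖ ^ 2 ≤ (inner ℂ f (mulOp hm f)).re := by
  have h1 : c * ‖f‖ ^ 2 = (inner ℂ f ((c : ℂ) • f)).re := by
    rw [inner_smul_right, inner_self_eq_norm_sq_to_K]
    norm_cast
    rw [Complex.re_ofReal_mul]
    rfl
  have h2 : 0 ≤ (inner ℂ f (mulOp hm f - (c : ℂ) • f)).re := by
    rw [L2.inner_def, ← RCLike.re_eq_complex_re, ← integral_re (L2.integrable_inner _ _)]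
    refine integral_nonneg_of_ae ?_
    filter_upwards [coeFn_mulOp hm f, Lp.coeFn_sub (mulOp hm f) ((c : ℂ) • f),
      Lp.coeFn_smul (c : ℂ) f, ae_restrict_mem measurableSet_Ioo] with x e1 e2 e3 hx
    have e4 : inner ℂ (f x) ((mulOp hm f - (c : ℂ) • f : IntervalL2 ℓ) x) =
        (((m x - c) * ‖f x‖ ^ 2 : ℝ) : ℂ) := by
      rw [e2, Pi.sub_apply, e1, e3, Pi.smul_apply, smul_eq_mul, ← sub_mul, ← smul_eq_mul,
        inner_smul_right, inner_self_eq_norm_sq_to_K]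
      push_cast
      rfl
    rw [e4]
    simp only [Pi.zero_apply, RCLike.re_eq_complex_re, Complex.ofReal_re]
    have := hc x (Set.Ioo_subset_Icc_self hx)
    have : 0 ≤ m x - c := by linarith
    positivity
  rw [inner_sub_right, Complex.sub_re, ← h1] at h2
  linarith

/-- The constant function `1` in `L²(0, ℓ)`. -/
def oneL2 (ℓ : ℝ) : IntervalL2 ℓ := (memLp_const (1 : ℂ)).toLp

theorem coeFn_oneL2 : oneL2 ℓ =ᵐ[intervalMeasure ℓ] fun _ => 1 := MemLp.coeFn_toLp _

theorem inner_oneL2_left (hℓ : 0 ≤ ℓ) (f : IntervalL2 ℓ) :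
    inner ℂ (oneL2 ℓ) f = ∫ t in (0 : ℝ)..ℓ, f t := by
  rw [L2.inner_def, intervalIntegral.integral_of_le hℓ, integral_Ioc_eq_integral_Ioo]
  refine integral_congr_ae ?_
  filter_upwards [coeFn_oneL2] with x hx
  simp [hx]

theorem HasACDeriv.conj {f g : ℝ → ℂ} (h : HasACDeriv ℓ f g) :
    HasACDeriv ℓ (fun x => (starRingEnd ℂ) (f x)) (fun x => (starRingEnd ℂ) (g x)) := by
  refine ⟨Complex.conjLIE.integrable_comp_iff.2 h.1, fun x hx => ?_⟩
  beta_reduce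
  rw [h.2 x hx, map_add, intervalIntegral.integral_of_le hx.1, intervalIntegral.integral_of_le hx.1,
    integral_conj]

/-- Integration by parts: the product of the primitives of `f̄` and `g` vanishes at `0`, so only its
value at `ℓ` remains. -/
theorem inner_volterra_add (hℓ : 0 ≤ ℓ) (f g : IntervalL2 ℓ) :
    inner ℂ f (volterra hℓ g) + inner ℂ (volterra hℓ f) g =
      inner ℂ f (oneL2 ℓ) * inner ℂ (oneL2 ℓ) g := by
  have h := (hasACDeriv_integral 0 f.integrableOn).conj.mul (hasACDeriv_integral 0 g.integrableOn) hℓ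
  have h2 := h.2 ℓ ⟨hℓ, le_rfl⟩
  simp only [zero_add, intervalIntegral.integral_same, mul_zero] at h2
  rw [← inner_conj_symm f (oneL2 ℓ), inner_oneL2_left hℓ, inner_oneL2_left hℓ, h2,
    intervalIntegral.integral_of_le hℓ, integral_Ioc_eq_integral_Ioo, L2.inner_def, L2.inner_def,
    ← integral_add (L2.integrable_inner _ _) (L2.integrable_inner _ _)]
  refine integral_congr_ae ?_
  filter_upwards [coeFn_volterra hℓ f, coeFn_volterra hℓ g] with x h1 h2
  simp only [h1, h2, RCLike.inner_apply]
  ring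

/-- `J + J* = ⟨1, ·⟩ 1` for the Volterra operator `J`. -/
theorem adjoint_volterra_apply (hℓ : 0 ≤ ℓ) (f : IntervalL2 ℓ) :
    ContinuousLinearMap.adjoint (volterra hℓ) f =
      inner ℂ (oneL2 ℓ) f • oneL2 ℓ - volterra hℓ f := by
  refine ext_inner_right ℂ fun g => ?_
  rw [ContinuousLinearMap.adjoint_inner_left, inner_sub_left, inner_smul_left, inner_conj_symm,
    ← inner_volterra_add hℓ f g]
  ring

end Operators

/-! ### A variational solution operator -/

section Variational

variable {L H : Type*} [NormedAddCommGroup L] [InnerProductSpace ℂ L] [CompleteSpace L]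
  [NormedAddCommGroup H] [InnerProductSpace ℂ H] [CompleteSpace H]

/-- If `B` is symmetric and coercive, `R` is compact and `V` is a closed subspace, then the weak
problem `w ∈ V`, `⟨η, B w⟩ = ⟨R η, f⟩` for all `η ∈ V` is solvable, and `f ↦ R w` is compact,
symmetric and nonnegative. -/
theorem exists_compact_solution_operator (B : L →L[ℂ] L) (hB : B.IsSymmetric) {c : ℝ} (hc : 0 < c)
    (hBc : ∀ w, c * ‖w‖ ^ 2 ≤ (inner ℂ w (B w)).re) (V : Submodule ℂ L) [CompleteSpace V]
    (R : L →L[ℂ] H) (hR : IsCompactOperator R) :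
    ∃ K : H →L[ℂ] H, IsCompactOperator K ∧ K.IsSymmetric ∧ (∀ f, 0 ≤ (inner ℂ f (K f)).re) ∧
      ∀ f, ∃ w ∈ V, K f = R w ∧ ∀ η ∈ V, inner ℂ η (B w) = inner ℂ (R η) f := by
  -- `S` is the compression of `B` to `V`. Coercivity makes it invertible (Lax–Milgram), and the
  -- solution operator is `RV S⁻¹ RV*`, with `RV` the restriction of `R` to `V`.
  let S : V →L[ℂ] V := (ContinuousLinearMap.adjoint V.subtypeL).comp (B.comp V.subtypeL)
  have hS : ∀ x y : V, inner ℂ x (S y) = inner ℂ (x : L) (B y) := fun x y => by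
    simp only [S, ContinuousLinearMap.comp_apply, ContinuousLinearMap.adjoint_inner_right]
    rfl
  have hSsymm : ∀ x y : V, inner ℂ (S x) y = inner ℂ x (S y) := fun x y => by
    rw [hS, ← inner_conj_symm, hS, inner_conj_symm]
    exact hB x y
  have hunit : IsUnit S := by
    refine ContinuousLinearMap.isUnit_of_forall_le_norm_inner_map S (c := ⟨c, hc.le⟩) hc fun x => ?_
    rw [hSsymm, hS]
    refine le_trans ?_ (Complex.re_le_norm _)
    rw [mul_comm]
    exact hBc x
  obtain ⟨S', hS'⟩ := hunit
  let T : V →L[ℂ] V := ((S'⁻¹ : (V →L[ℂ] V)ˣ) : V →L[ℂ] V)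
  have hST : ∀ x, S (T x) = x := fun x => by
    have h : (S' : V →L[ℂ] V) * T = 1 := S'.mul_inv
    rw [← hS']
    exact DFunLike.congr_fun h x
  let RV : V →L[ℂ] H := R.comp V.subtypeL
  let P := ContinuousLinearMap.adjoint RV
  have hTsymm : ∀ x y : V, inner ℂ (T x) y = inner ℂ x (T y) := fun x y => by
    conv_lhs => rw [← hST y]
    rw [← hSsymm, hST]
  refine ⟨RV.comp (T.comp P), ?_, ?_, ?_, ?_⟩
  · exact (hR.comp_clm V.subtypeL).comp_clm (T.comp P)
  · intro f g
    change inner ℂ (RV (T (P f))) g = inner ℂ f (RV (T (P g)))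
    exact ((ContinuousLinearMap.adjoint_inner_right RV _ _).symm.trans (hTsymm _ _)).trans
      (ContinuousLinearMap.adjoint_inner_left RV _ _)
  · intro f
    change 0 ≤ (inner ℂ f (RV (T (P f)))).re
    rw [← ContinuousLinearMap.adjoint_inner_left]
    change 0 ≤ (inner ℂ (P f) (T (P f))).re
    have h := hS (T (P f)) (T (P f))
    rw [hST, hTsymm] at h
    rw [h]
    exact (by positivity : 0 ≤ c * ‖(T (P f) : L)‖ ^ 2).trans (hBc _)
  · intro f
    refine ⟨T (P f), (T (P f)).2, rfl, fun η hη => ?_⟩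
    have := hS ⟨η, hη⟩ (T (P f))
    rw [hST] at this
    rw [← this]
    exact ContinuousLinearMap.adjoint_inner_right _ _ _

end Variational

/-! ### The weighted space -/

section Weighted

variable {ℓ : ℝ} {ρ : ℝ → ℝ}

theorem HasACDeriv.continuousOn_real {f g : ℝ → ℝ} (h : HasACDeriv ℓ f g) (hℓ : 0 ≤ ℓ) :
    ContinuousOn f (Set.Icc 0 ℓ) :=
  (Complex.continuous_re.comp_continuousOn (h.ofReal.continuousOn hℓ)).congr fun _ _ => rfl

theorem isFiniteMeasure_weightMeasure (hρ : ContinuousOn ρ (Set.Icc 0 ℓ)) :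
    IsFiniteMeasure (weightMeasure ℓ ρ) := by
  refine isFiniteMeasure_withDensity_ofReal ?_
  exact (hρ.integrableOn_Icc.mono_set Set.Ioo_subset_Icc_self).2

theorem weightMeasure_absolutelyContinuous : weightMeasure ℓ ρ ≪ intervalMeasure ℓ :=
  withDensity_absolutelyContinuous _ _

theorem aemeasurable_ofReal_weight (hρ : ContinuousOn ρ (Set.Icc 0 ℓ)) :
    AEMeasurable (fun x => ENNReal.ofReal (ρ x)) (intervalMeasure ℓ) :=
  (aestronglyMeasurable_of_continuousOn_Icc hρ).aemeasurable.ennreal_ofReal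

theorem absolutelyContinuous_weightMeasure (hρ : ContinuousOn ρ (Set.Icc 0 ℓ))
    (hpos : ∀ x ∈ Set.Icc 0 ℓ, 0 < ρ x) : intervalMeasure ℓ ≪ weightMeasure ℓ ρ := by
  refine withDensity_absolutelyContinuous' (aemeasurable_ofReal_weight hρ) ?_
  filter_upwards [ae_restrict_mem measurableSet_Ioo] with x hx
  simpa using hpos x (Set.Ioo_subset_Icc_self hx)

/-- The lower bound on `ρ` gives `dx ≤ ρ₀⁻¹ ρ dx` on `(0, ℓ)`. -/
theorem memLp_interval_of_weighted {ρ₀ : ℝ} (hρ₀ : 0 < ρ₀)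
    (hle : ∀ x ∈ Set.Icc 0 ℓ, ρ₀ ≤ ρ x) (f : WeightedL2 ℓ ρ) :
    MemLp f 2 (intervalMeasure ℓ) := by
  refine (Lp.memLp f).of_measure_le_smul (c := ENNReal.ofReal ρ₀⁻¹) ENNReal.ofReal_ne_top ?_
  rw [weightMeasure, ← withDensity_smul' _ _ ENNReal.ofReal_ne_top]
  conv_lhs => rw [← withDensity_one (μ := intervalMeasure ℓ)]
  refine withDensity_mono ?_
  filter_upwards [ae_restrict_mem measurableSet_Ioo] with x hx
  have hx' := hle x (Set.Ioo_subset_Icc_self hx)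
  simp only [Pi.one_apply, Pi.smul_apply, smul_eq_mul]
  rw [← ENNReal.ofReal_mul (by positivity), ENNReal.one_le_ofReal, inv_mul_eq_div,
    one_le_div hρ₀]
  exact hx'

theorem inner_weightedL2 (hρ : ContinuousOn ρ (Set.Icc 0 ℓ))
    (hpos : ∀ x ∈ Set.Icc 0 ℓ, 0 < ρ x) (f g : WeightedL2 ℓ ρ) :
    inner ℂ f g = ∫ x, (ρ x : ℂ) * inner ℂ (f x) (g x) ∂intervalMeasure ℓ := by
  rw [L2.inner_def]
  change ∫ x, _ ∂((volume.restrict (Set.Ioo 0 ℓ)).withDensity _) = _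
  rw [integral_withDensity_eq_integral_toReal_smul₀
    (aemeasurable_ofReal_weight hρ) (.of_forall fun _ => ENNReal.ofReal_lt_top)]
  refine integral_congr_ae ?_
  filter_upwards [ae_restrict_mem measurableSet_Ioo] with x hx
  rw [ENNReal.toReal_ofReal (hpos x (Set.Ioo_subset_Icc_self hx)).le, Complex.real_smul]

end Weighted

/-! ### `H²` functions on the interval -/

section SobolevTwo

variable {ℓ : ℝ}

/-- `f ∈ H²(0, ℓ)` with `f' = f₁` and `f'' = f₂`. -/
structure HasH2Deriv (ℓ : ℝ) (f f₁ f₂ : ℝ → ℂ) : Prop where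
  fst : HasACDeriv ℓ f f₁
  snd : HasACDeriv ℓ f₁ f₂
  memLp : MemLp f₂ 2 (intervalMeasure ℓ)

theorem memLp_of_continuousOn {f : ℝ → ℂ} (hf : ContinuousOn f (Set.Icc 0 ℓ)) :
    MemLp f 2 (intervalMeasure ℓ) := by
  have h : MemLp (fun _ : ℝ => (1 : ℂ)) 2 (intervalMeasure ℓ) := memLp_const 1
  simpa using h.continuousOn_mul hf

theorem HasACDeriv.neg {f g : ℝ → ℂ} (h : HasACDeriv ℓ f g) :
    HasACDeriv ℓ (fun x => -f x) (fun x => -g x) := by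
  have h' := h.const_smul (-1)
  have e : ∀ f : ℝ → ℂ, (-1 : ℂ) • f = fun x => -f x := fun f => by ext x; simp
  rwa [e, e] at h'

theorem HasH2Deriv.mul {f f₁ f₂ g g₁ g₂ : ℝ → ℂ} (hf : HasH2Deriv ℓ f f₁ f₂)
    (hg : HasH2Deriv ℓ g g₁ g₂) (hℓ : 0 ≤ ℓ) :
    HasH2Deriv ℓ (fun x => f x * g x) (fun x => f₁ x * g x + f x * g₁ x)
      (fun x => (f₂ x * g x + f₁ x * g₁ x) + (f₁ x * g₁ x + f x * g₂ x)) where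
  fst := hf.fst.mul hg.fst hℓ
  snd := (hf.snd.mul hg.fst hℓ).add (hf.fst.mul hg.snd hℓ)
  memLp := by
    have hc := memLp_of_continuousOn ((hf.snd.continuousOn hℓ).mul (hg.snd.continuousOn hℓ))
    have h' : MemLp (fun x => f₂ x * g x) 2 (intervalMeasure ℓ) := by
      simpa only [mul_comm] using hf.memLp.continuousOn_mul (hg.fst.continuousOn hℓ)
    exact (h'.add hc).add (hc.add (hg.memLp.continuousOn_mul (hf.fst.continuousOn hℓ)))

/-- The second derivative of `1 / f` is `f₂` times a continuous function plus a continuous function,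
hence in `L²`. -/
theorem HasH2Deriv.exists_inv {f f₁ f₂ : ℝ → ℂ} (hf : HasH2Deriv ℓ f f₁ f₂) (hℓ : 0 ≤ ℓ)
    (h0 : ∀ x ∈ Set.Icc 0 ℓ, f x ≠ 0) : ∃ g₁ g₂, HasH2Deriv ℓ (fun x => (f x)⁻¹) g₁ g₂ := by
  have h1 := hf.fst.inv_of_continuousOn (hf.snd.continuousOn hℓ) hℓ h0
  have h2 := hf.snd.neg.mul (h1.mul h1 hℓ) hℓ
  refine ⟨_, _, h1, h2, ?_⟩
  have hc : ContinuousOn (fun x => (f x)⁻¹) (Set.Icc 0 ℓ) := h1.continuousOn hℓ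
  have hc1 := (hf.snd.continuousOn hℓ).neg.mul (hc.mul hc)
  refine MemLp.add ?_ (memLp_of_continuousOn ((hf.snd.continuousOn hℓ).neg.mul
    ((hc1.mul hc).add (hc.mul hc1))))
  have := hf.memLp.neg.continuousOn_mul (hc.mul hc)
  refine this.ae_eq (.of_forall fun x => ?_)
  simp only [Pi.neg_apply, Pi.mul_apply]
  ring

theorem isSobolevJet_four_of_deriv {f₀ f₁ f₂ f₃ f₄ : ℝ → ℂ} (h₀ : HasACDeriv ℓ f₀ f₁)
    (h₁ : HasACDeriv ℓ f₁ f₂) (h₂ : HasH2Deriv ℓ f₂ f₃ f₄) (hℓ : 0 ≤ ℓ) :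
    IsSobolevJet ℓ 4 (fun j => [f₀, f₁, f₂, f₃, f₄].getD j 0) := by
  refine ⟨fun j hj => ?_, fun j hj => ?_⟩
  · interval_cases j
    · exact h₀
    · exact h₁
    · exact h₂.fst
    · exact h₂.snd
  · interval_cases j
    · exact memLp_of_continuousOn (h₀.continuousOn hℓ)
    · exact memLp_of_continuousOn (h₁.continuousOn hℓ)
    · exact memLp_of_continuousOn (h₂.fst.continuousOn hℓ)
    · exact memLp_of_continuousOn (h₂.snd.continuousOn hℓ)
    · exact h₂.memLp

theorem HasH2Deriv.isSobolevJet {f₀ f₁ f₂ : ℝ → ℂ} (h : HasH2Deriv ℓ f₀ f₁ f₂) (hℓ : 0 ≤ ℓ) :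
    IsSobolevJet ℓ 2 (fun j => [f₀, f₁, f₂].getD j 0) := by
  refine ⟨fun j hj => ?_, fun j hj => ?_⟩
  · interval_cases j
    · exact h.fst
    · exact h.snd
  · interval_cases j
    · exact memLp_of_continuousOn (h.fst.continuousOn hℓ)
    · exact memLp_of_continuousOn (h.snd.continuousOn hℓ)
    · exact h.memLp

theorem isSobolevJet_one_of_deriv {f₀ f₁ : ℝ → ℂ} (h : HasACDeriv ℓ f₀ f₁)
    (h₁ : MemLp f₁ 2 (intervalMeasure ℓ)) (hℓ : 0 ≤ ℓ) :
    IsSobolevJet ℓ 1 (fun j => [f₀, f₁].getD j 0) := by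
  refine ⟨fun j hj => ?_, fun j hj => ?_⟩
  · interval_cases j
    exact h
  · interval_cases j
    · exact memLp_of_continuousOn (h.continuousOn hℓ)
    · exact h₁

end SobolevTwo

/-! ### The energy form -/

section Energy

variable {ℓ : ℝ} {ρ σ q : ℝ → ℝ}

/-- The second derivatives of the functions in `H²₀(0, ℓ)`: the orthogonal complement of the affine
functions. -/
def clampedSpace (hℓ : 0 ≤ ℓ) : Submodule ℂ (IntervalL2 ℓ) :=
  (Submodule.span ℂ {oneL2 ℓ, ContinuousLinearMap.adjoint (volterra hℓ) (oneL2 ℓ)})ᗮ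

instance (hℓ : 0 ≤ ℓ) : CompleteSpace (clampedSpace hℓ) :=
  (Submodule.isClosed_orthogonal _).completeSpace_coe

/-- For `y = J² w` the two conditions are `y'(ℓ) = 0` and `y(ℓ) = 0`. -/
theorem mem_clampedSpace_iff (hℓ : 0 ≤ ℓ) (w : IntervalL2 ℓ) :
    w ∈ clampedSpace hℓ ↔ inner ℂ (oneL2 ℓ) w = 0 ∧ inner ℂ (oneL2 ℓ) (volterra hℓ w) = 0 := by
  rw [clampedSpace, Submodule.mem_orthogonal]
  constructor
  · intro h
    refine ⟨h _ (Submodule.subset_span (by simp)), ?_⟩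
    rw [← ContinuousLinearMap.adjoint_inner_left]
    exact h _ (Submodule.subset_span (by simp))
  · rintro ⟨h1, h2⟩ u hu
    obtain ⟨a, b, rfl⟩ := Submodule.mem_span_pair.1 hu
    rw [inner_add_left, inner_smul_left, inner_smul_left, h1,
      ContinuousLinearMap.adjoint_inner_left, h2, mul_zero, mul_zero, add_zero]

/-- The operator of the form `∫ σ w η̄ + ∫ q (J w) (J η)⁻`, where `J` is the Volterra operator. -/
def energyOp (hℓ : 0 ≤ ℓ) (hσ : ContinuousOn σ (Set.Icc 0 ℓ)) (hq : ContinuousOn q (Set.Icc 0 ℓ)) :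
    IntervalL2 ℓ →L[ℂ] IntervalL2 ℓ :=
  mulOp hσ + (ContinuousLinearMap.adjoint (volterra hℓ)).comp ((mulOp hq).comp (volterra hℓ))

theorem energyOp_apply (hℓ : 0 ≤ ℓ) (hσ : ContinuousOn σ (Set.Icc 0 ℓ))
    (hq : ContinuousOn q (Set.Icc 0 ℓ)) (w : IntervalL2 ℓ) :
    energyOp hℓ hσ hq w = mulOp hσ w +
      ContinuousLinearMap.adjoint (volterra hℓ) (mulOp hq (volterra hℓ w)) := rfl

theorem isSymmetric_energyOp (hℓ : 0 ≤ ℓ) (hσ : ContinuousOn σ (Set.Icc 0 ℓ))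
    (hq : ContinuousOn q (Set.Icc 0 ℓ)) : (energyOp hℓ hσ hq).IsSymmetric := by
  intro f g
  change inner ℂ (energyOp hℓ hσ hq f) g = inner ℂ f (energyOp hℓ hσ hq g)
  rw [energyOp_apply, energyOp_apply, inner_add_left, inner_add_right, inner_mulOp_left,
    ContinuousLinearMap.adjoint_inner_left, ContinuousLinearMap.adjoint_inner_right,
    inner_mulOp_left]

/-- The `σ` term alone supplies the coercivity; the `q` term is nonnegative. -/
theorem le_re_inner_energyOp (hℓ : 0 ≤ ℓ) (hσ : ContinuousOn σ (Set.Icc 0 ℓ))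
    (hq : ContinuousOn q (Set.Icc 0 ℓ)) {c : ℝ} (hc : ∀ x ∈ Set.Icc 0 ℓ, c ≤ σ x)
    (hq₀ : ∀ x ∈ Set.Icc 0 ℓ, 0 ≤ q x) (w : IntervalL2 ℓ) :
    c * ‖w‖ ^ 2 ≤ (inner ℂ w (energyOp hℓ hσ hq w)).re := by
  rw [energyOp_apply, inner_add_right, ContinuousLinearMap.adjoint_inner_right, Complex.add_re]
  have h1 := le_re_inner_mulOp hσ hc w
  have h2 := le_re_inner_mulOp hq hq₀ (volterra hℓ w)
  linarith

/-- The operator `w ↦ ∫₀ˣ ∫₀ˢ w` from `L²(0, ℓ)` to `L²_ρ(0, ℓ)`. -/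
def weightedVolterraSq (hℓ : 0 ≤ ℓ) (hρ : ContinuousOn ρ (Set.Icc 0 ℓ)) :
    IntervalL2 ℓ →L[ℂ] WeightedL2 ℓ ρ :=
  haveI := isFiniteMeasure_weightMeasure hρ
  ((contToL2 hℓ (weightMeasure ℓ ρ)).comp (volterraCont hℓ)).comp (volterra hℓ)

theorem isCompactOperator_weightedVolterraSq (hℓ : 0 ≤ ℓ) (hρ : ContinuousOn ρ (Set.Icc 0 ℓ)) :
    IsCompactOperator (weightedVolterraSq hℓ hρ) :=
  haveI := isFiniteMeasure_weightMeasure hρ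
  ((isCompactOperator_volterraCont hℓ).clm_comp (contToL2 hℓ (weightMeasure ℓ ρ))).comp_clm
    (volterra hℓ)

theorem coeFn_weightedVolterraSq (hℓ : 0 ≤ ℓ) (hρ : ContinuousOn ρ (Set.Icc 0 ℓ))
    (w : IntervalL2 ℓ) : weightedVolterraSq hℓ hρ w =ᵐ[weightMeasure ℓ ρ]
      fun x => ∫ t in (0 : ℝ)..x, volterra hℓ w t :=
  haveI := isFiniteMeasure_weightMeasure hρ
  coeFn_contToL2 hℓ weightMeasure_absolutelyContinuous _ fun _ => rfl

/-- Moving the weight onto the datum, `F = ρ f`, turns the right-hand side of the weak problem into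
an unweighted inner product. -/
theorem inner_weightedVolterraSq (hℓ : 0 ≤ ℓ) (hρ : ContinuousOn ρ (Set.Icc 0 ℓ))
    (hpos : ∀ x ∈ Set.Icc 0 ℓ, 0 < ρ x) (w F : IntervalL2 ℓ) (f : WeightedL2 ℓ ρ)
    (hF : F =ᵐ[intervalMeasure ℓ] fun x => (ρ x : ℂ) * f x) :
    inner ℂ (weightedVolterraSq hℓ hρ w) f = inner ℂ (volterra hℓ (volterra hℓ w)) F := by
  rw [inner_weightedL2 hρ hpos, L2.inner_def]
  refine integral_congr_ae ?_
  filter_upwards [hF, coeFn_volterra hℓ (volterra hℓ w),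
    (absolutelyContinuous_weightMeasure hρ hpos).ae_le (coeFn_weightedVolterraSq hℓ hρ w)]
    with x h1 h2 h3
  rw [h1, h2, h3, ← smul_eq_mul (ρ x : ℂ) (f x), inner_smul_right]

end Energy

/-! ### The clamped operator is the inverse of the variational solution operator -/

section ClampedGraph

variable {ℓ : ℝ} {ρ σ q : ℝ → ℝ}

/-- A du Bois-Reymond lemma: the residual is orthogonal to everything orthogonal to the affine
functions, hence is itself affine. Replacing each `J*` by `⟨1, ·⟩ 1 - J` changes only the affine
part and leaves an integrated equation. -/
theorem exists_mulOp_eq_of_weak (hℓ : 0 ≤ ℓ) (hσ : ContinuousOn σ (Set.Icc 0 ℓ))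
    (hq : ContinuousOn q (Set.Icc 0 ℓ)) {w F : IntervalL2 ℓ}
    (h : ∀ η ∈ clampedSpace hℓ, inner ℂ η (energyOp hℓ hσ hq w) =
      inner ℂ (volterra hℓ (volterra hℓ η)) F) :
    ∃ a b : ℂ, mulOp hσ w = a • oneL2 ℓ + b • volterra hℓ (oneL2 ℓ) +
      volterra hℓ (mulOp hq (volterra hℓ w)) + volterra hℓ (volterra hℓ F) := by
  set J := volterra hℓ with hJ
  set J' := ContinuousLinearMap.adjoint J with hJ'
  have h1 : energyOp hℓ hσ hq w - J' (J' F) ∈ Submodule.span ℂ {oneL2 ℓ, J' (oneL2 ℓ)} := by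
    have : FiniteDimensional ℂ (Submodule.span ℂ {oneL2 ℓ, J' (oneL2 ℓ)}) :=
      FiniteDimensional.span_of_finite ℂ (by simp)
    rw [← Submodule.orthogonal_orthogonal (Submodule.span ℂ {oneL2 ℓ, J' (oneL2 ℓ)}),
      Submodule.mem_orthogonal]
    intro η hη
    rw [inner_sub_right, h η hη, ContinuousLinearMap.adjoint_inner_right,
      ContinuousLinearMap.adjoint_inner_right, sub_self]
  obtain ⟨a, b, hab⟩ := Submodule.mem_span_pair.1 h1
  have hadj : ∀ f, J' f = inner ℂ (oneL2 ℓ) f • oneL2 ℓ - J f := adjoint_volterra_apply hℓ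
  have h2 := eq_add_of_sub_eq hab.symm
  rw [energyOp_apply, ← hJ, ← hJ', hadj (mulOp hq (J w)), hadj (oneL2 ℓ), hadj (J' F),
    hadj F, map_sub, map_smul] at h2
  refine ⟨a + b * inner ℂ (oneL2 ℓ) (oneL2 ℓ) +
    inner ℂ (oneL2 ℓ) (inner ℂ (oneL2 ℓ) F • oneL2 ℓ - J F) -
    inner ℂ (oneL2 ℓ) (mulOp hq (J w)), -b - inner ℂ (oneL2 ℓ) F, ?_⟩
  have h3 := eq_sub_of_add_eq h2
  rw [h3]
  module

theorem integral_coeFn_volterra (hℓ : 0 ≤ ℓ) (f : IntervalL2 ℓ) {x : ℝ} (hx : x ∈ Set.Icc 0 ℓ) :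
    ∫ t in (0 : ℝ)..x, volterra hℓ f t = ∫ t in (0 : ℝ)..x, ∫ s in (0 : ℝ)..t, f s :=
  intervalIntegral_congr_ae_Ioo (coeFn_volterra hℓ f) hx

/-- Regularity of weak solutions. The integrated equation gives `σ w` an `H²` representative `s₀`,
so `y'' = s₀ / σ` is a representative of `w` in `H²`. -/
theorem mem_clampedGraph_of_weak (hℓ : 0 < ℓ) (hρ : ContinuousOn ρ (Set.Icc 0 ℓ))
    {ρ₀ : ℝ} (hρ₀ : 0 < ρ₀) (hle : ∀ x ∈ Set.Icc 0 ℓ, ρ₀ ≤ ρ x)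
    {σ₁ σ₂ : ℝ → ℂ} (hσ : HasH2Deriv ℓ (fun x => (σ x : ℂ)) σ₁ σ₂)
    (hσpos : ∀ x ∈ Set.Icc 0 ℓ, 0 < σ x) (hσc : ContinuousOn σ (Set.Icc 0 ℓ))
    {q₁ : ℝ → ℂ} (hq : HasACDeriv ℓ (fun x => (q x : ℂ)) q₁) (hq₁ : MemLp q₁ 2 (intervalMeasure ℓ))
    (hqc : ContinuousOn q (Set.Icc 0 ℓ)) {w : IntervalL2 ℓ} (hw : w ∈ clampedSpace hℓ.le)
    {f : WeightedL2 ℓ ρ} (h : ∀ η ∈ clampedSpace hℓ.le, inner ℂ η (energyOp hℓ.le hσc hqc w) =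
      inner ℂ (weightedVolterraSq hℓ.le hρ η) f) :
    (weightedVolterraSq hℓ.le hρ w, f) ∈ clampedGraph ℓ ρ σ q := by
  have hρpos : ∀ x ∈ Set.Icc 0 ℓ, 0 < ρ x := fun x hx => hρ₀.trans_le (hle x hx)
  have hρf : MemLp (fun x => (ρ x : ℂ) * f x) 2 (intervalMeasure ℓ) :=
    (memLp_interval_of_weighted hρ₀ hle f).continuousOn_mul
      (Complex.continuous_ofReal.comp_continuousOn hρ)
  set F : IntervalL2 ℓ := hρf.toLp with hF
  have hFae : F =ᵐ[intervalMeasure ℓ] fun x => (ρ x : ℂ) * f x := hρf.coeFn_toLp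
  obtain ⟨a, b, hab⟩ := exists_mulOp_eq_of_weak hℓ.le hσc hqc (w := w) (F := F) fun η hη => by
    rw [h η hη, inner_weightedVolterraSq hℓ.le hρ hρpos η F f hFae]
  obtain ⟨hw1, hw2⟩ := (mem_clampedSpace_iff hℓ.le w).1 hw
  rw [inner_oneL2_left hℓ.le] at hw1 hw2
  -- the functions `y'`, `y`, `σ y''` and `(σ y'')'`
  set y₁ : ℝ → ℂ := fun x => 0 + ∫ t in (0 : ℝ)..x, w t with hy₁
  have hy₁w : HasACDeriv ℓ y₁ w := hasACDeriv_integral 0 w.integrableOn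
  have hy₁c := hy₁w.continuousOn hℓ.le
  set y₀ : ℝ → ℂ := fun x => 0 + ∫ t in (0 : ℝ)..x, y₁ t with hy₀
  have hy₀y₁ : HasACDeriv ℓ y₀ y₁ :=
    hasACDeriv_integral 0 (memLp_of_continuousOn hy₁c).integrableOn_Ioo
  have hqy₁ : HasACDeriv ℓ (fun x => (q x : ℂ) * y₁ x) (fun x => q₁ x * y₁ x + q x * w x) :=
    hq.mul hy₁w hℓ.le
  have hqy₁L : MemLp (fun x => q₁ x * y₁ x + q x * w x) 2 (intervalMeasure ℓ) := by
    refine MemLp.add ?_ ((Lp.memLp w).continuousOn_mul (hq.continuousOn hℓ.le))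
    simpa only [mul_comm (q₁ _)] using hq₁.continuousOn_mul hy₁c
  set s₁ : ℝ → ℂ := fun x => (q x : ℂ) * y₁ x + (b + ∫ t in (0 : ℝ)..x, F t) with hs₁
  set s₂ : ℝ → ℂ := fun x => (q₁ x * y₁ x + q x * w x) + F x with hs₂
  have hs₁s₂ : HasACDeriv ℓ s₁ s₂ := hqy₁.add (hasACDeriv_integral b F.integrableOn)
  set s₀ : ℝ → ℂ := fun x => a + ∫ t in (0 : ℝ)..x, s₁ t with hs₀
  have hs : HasH2Deriv ℓ s₀ s₁ s₂ :=
    ⟨hasACDeriv_integral a (memLp_of_continuousOn (hs₁s₂.continuousOn hℓ.le)).integrableOn_Ioo,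
      hs₁s₂, hqy₁L.add (Lp.memLp F)⟩
  have hσ0 : ∀ x ∈ Set.Icc 0 ℓ, (σ x : ℂ) ≠ 0 := fun x hx => by
    exact_mod_cast (hσpos x hx).ne'
  obtain ⟨τ₁, τ₂, hτ⟩ := hσ.exists_inv hℓ.le hσ0
  have hy₂ := hs.mul hτ hℓ.le
  have hs₀eq : ∀ᵐ x ∂intervalMeasure ℓ, (σ x : ℂ) * w x = s₀ x := by
    have e0 := coeFn_mulOp hσc w
    rw [hab] at e0
    filter_upwards [e0, ae_restrict_mem measurableSet_Ioo,
      Lp.coeFn_add (a • oneL2 ℓ + b • volterra hℓ.le (oneL2 ℓ) +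
        volterra hℓ.le (mulOp hqc (volterra hℓ.le w))) (volterra hℓ.le (volterra hℓ.le F)),
      Lp.coeFn_add (a • oneL2 ℓ + b • volterra hℓ.le (oneL2 ℓ))
        (volterra hℓ.le (mulOp hqc (volterra hℓ.le w))),
      Lp.coeFn_add (a • oneL2 ℓ) (b • volterra hℓ.le (oneL2 ℓ)),
      Lp.coeFn_smul a (oneL2 ℓ), Lp.coeFn_smul b (volterra hℓ.le (oneL2 ℓ)),
      coeFn_oneL2 (ℓ := ℓ), coeFn_volterra hℓ.le (oneL2 ℓ),
      coeFn_volterra hℓ.le (mulOp hqc (volterra hℓ.le w)),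
      coeFn_volterra hℓ.le (volterra hℓ.le F)] with x e0 hx e1 e2 e3 e4 e5 e6 e7 e8 e9
    have hx' := Set.Ioo_subset_Icc_self hx
    have h0' : (0 : ℝ) ∈ Set.Icc 0 ℓ := ⟨le_rfl, hℓ.le⟩
    rw [← e0, e1, Pi.add_apply, e2, Pi.add_apply, e3, Pi.add_apply, e4, e5, Pi.smul_apply,
      Pi.smul_apply, e6, e7, e8, e9, smul_eq_mul, smul_eq_mul, mul_one]
    have i1 : ∫ t in (0 : ℝ)..x, oneL2 ℓ t = ∫ t in (0 : ℝ)..x, (1 : ℂ) :=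
      intervalIntegral_congr_ae_Ioo coeFn_oneL2 hx'
    have i2 : ∫ t in (0 : ℝ)..x, mulOp hqc (volterra hℓ.le w) t =
        ∫ t in (0 : ℝ)..x, (q t : ℂ) * y₁ t := by
      refine intervalIntegral_congr_ae_Ioo ?_ hx'
      filter_upwards [coeFn_mulOp hqc (volterra hℓ.le w), coeFn_volterra hℓ.le w] with t h1 h2
      rw [h1, h2]
      simp only [hy₁, zero_add]
    have c1 := (hqy₁.continuousOn hℓ.le)
    have c2 := (hasACDeriv_integral b F.integrableOn).continuousOn hℓ.le
    have c3 := (hasACDeriv_integral 0 F.integrableOn).continuousOn hℓ.le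
    simp only [zero_add] at c3
    have hint : ∀ {k : ℝ → ℂ}, ContinuousOn k (Set.Icc 0 ℓ) → IntervalIntegrable k volume 0 x :=
      fun hk => intervalIntegrable_of_integrableOn_Ioo
        (memLp_of_continuousOn hk).integrableOn_Ioo h0' hx'
    have i3 : ∫ t in (0 : ℝ)..x, s₁ t = (∫ t in (0 : ℝ)..x, (q t : ℂ) * y₁ t) +
        ((∫ t in (0 : ℝ)..x, b) + ∫ t in (0 : ℝ)..x, ∫ r in (0 : ℝ)..t, F r) := by
      rw [← intervalIntegral.integral_add (hint continuousOn_const) (hint c3),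
        ← intervalIntegral.integral_add (hint c1) (hint c2)]
    rw [i1, i2, integral_coeFn_volterra hℓ.le F hx', hs₀]
    simp only [i3, intervalIntegral.integral_const, Complex.real_smul]
    ring
  have hwy₂ : (fun x => s₀ x * (σ x : ℂ)⁻¹) =ᵐ[intervalMeasure ℓ] w := by
    filter_upwards [hs₀eq, ae_restrict_mem measurableSet_Ioo] with x hx hx'
    rw [← hx, mul_comm, inv_mul_cancel_left₀ (hσ0 x (Set.Ioo_subset_Icc_self hx'))]
  -- The graph requires `W 0 = σ Y 2` at every real `x`, so the product is kept unsimplified; it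
  -- agrees with `s₀` on `[0, ℓ]`, where `σ ≠ 0`.
  refine ⟨_, fun j => [fun x => (σ x : ℂ) * (s₀ x * (σ x : ℂ)⁻¹), s₁, s₂].getD j 0, _,
    isSobolevJet_four_of_deriv hy₀y₁ (hy₁w.congr hℓ.le (Set.eqOn_refl _ _) hwy₂) hy₂ hℓ.le,
    ⟨?_, ?_, ?_, ?_⟩, ⟨HasH2Deriv.isSobolevJet ⟨hs.fst.congr hℓ.le ?_ (by rfl), hs.snd, hs.memLp⟩
      hℓ.le, fun x => rfl⟩,
    ⟨isSobolevJet_one_of_deriv hqy₁ hqy₁L hℓ.le, fun x => rfl⟩, ?_, ?_⟩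
  · simp [hy₀]
  · simp [hy₁]
  · change 0 + ∫ t in (0 : ℝ)..ℓ, y₁ t = 0
    rw [integral_coeFn_volterra hℓ.le w ⟨hℓ.le, le_rfl⟩] at hw2
    simpa only [hy₁, zero_add] using hw2
  · change 0 + ∫ t in (0 : ℝ)..ℓ, w t = 0
    rw [hw1, zero_add]
  · intro x hx
    change (σ x : ℂ) * (s₀ x * (σ x : ℂ)⁻¹) = s₀ x
    rw [mul_comm (s₀ x), mul_inv_cancel_left₀ (hσ0 x hx)]
  · filter_upwards [coeFn_weightedVolterraSq hℓ.le hρ w,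
      weightMeasure_absolutelyContinuous.ae_le (ae_restrict_mem measurableSet_Ioo)] with x h1 h2
    change weightedVolterraSq hℓ.le hρ w x = 0 + ∫ t in (0 : ℝ)..x, y₁ t
    rw [h1, integral_coeFn_volterra hℓ.le w (Set.Ioo_subset_Icc_self h2), zero_add]
    simp only [hy₁, zero_add]
  · filter_upwards [weightMeasure_absolutelyContinuous.ae_le hFae,
      weightMeasure_absolutelyContinuous.ae_le (ae_restrict_mem measurableSet_Ioo)] with x h1 h2
    change f x = (ρ x : ℂ)⁻¹ * (((q₁ x * y₁ x + q x * w x) + F x) - (q₁ x * y₁ x + q x * w x))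
    have : (ρ x : ℂ) ≠ 0 := by exact_mod_cast (hρpos x (Set.Ioo_subset_Icc_self h2)).ne'
    rw [add_sub_cancel_left, h1, inv_mul_cancel_left₀ this]

/-- Integrating `(σ y'')'' = (q y')'` twice shows that the energy operator sends `w = y''` to an
affine function. As `w` is orthogonal to those, its energy vanishes, and coercivity gives `w = 0`.
-/
theorem clampedGraph_fst_eq_zero (hℓ : 0 < ℓ) (hρ : ContinuousOn ρ (Set.Icc 0 ℓ))
    (hρpos : ∀ x ∈ Set.Icc 0 ℓ, 0 < ρ x) (hσ : ContinuousOn σ (Set.Icc 0 ℓ)) {σ₀ : ℝ}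
    (hσ₀ : 0 < σ₀) (hσle : ∀ x ∈ Set.Icc 0 ℓ, σ₀ ≤ σ x) (hq : ContinuousOn q (Set.Icc 0 ℓ))
    (hq₀ : ∀ x ∈ Set.Icc 0 ℓ, 0 ≤ q x) {u : WeightedL2 ℓ ρ} (h : (u, 0) ∈ clampedGraph ℓ ρ σ q) :
    u = 0 := by
  obtain ⟨Y, W, Q, hY, ⟨hb1, hb2, hb3, hb4⟩, ⟨hW, hW0⟩, ⟨hQ, hQ0⟩, h1, h2⟩ := h
  have h0' : (0 : ℝ) ∈ Set.Icc 0 ℓ := ⟨le_rfl, hℓ.le⟩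
  have hℓ' : ℓ ∈ Set.Icc 0 ℓ := ⟨hℓ.le, le_rfl⟩
  have hac := absolutelyContinuous_weightMeasure hρ hρpos
  have hWQ : W 2 =ᵐ[intervalMeasure ℓ] Q 1 := by
    filter_upwards [hac.ae_le h2, hac.ae_le (Lp.coeFn_zero ℂ 2 (weightMeasure ℓ ρ)),
      ae_restrict_mem measurableSet_Ioo] with x h3 h4 hx
    have : (ρ x : ℂ) ≠ 0 := by exact_mod_cast (hρpos x (Set.Ioo_subset_Icc_self hx)).ne'
    rw [h4] at h3
    have h5 := (mul_eq_zero.1 h3.symm).resolve_left (inv_ne_zero this)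
    exact sub_eq_zero.1 h5
  set w : IntervalL2 ℓ := (hY.2 2 (by norm_num)).toLp with hw
  have hwY : w =ᵐ[intervalMeasure ℓ] Y 2 := MemLp.coeFn_toLp _
  have hY1 : ∀ x ∈ Set.Icc 0 ℓ, ∫ t in (0 : ℝ)..x, w t = Y 1 x := fun x hx => by
    rw [(hY.1 1 (by norm_num)).2 x hx, hb2, zero_add]
    exact intervalIntegral_congr_ae_Ioo hwY hx
  have hJw : volterra hℓ.le w =ᵐ[intervalMeasure ℓ] Y 1 := by
    filter_upwards [coeFn_volterra hℓ.le w, ae_restrict_mem measurableSet_Ioo] with x h3 hx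
    rw [h3, hY1 x (Set.Ioo_subset_Icc_self hx)]
  have hY0 : ∀ x ∈ Set.Icc 0 ℓ, ∫ t in (0 : ℝ)..x, volterra hℓ.le w t = Y 0 x := fun x hx => by
    rw [(hY.1 0 (by norm_num)).2 x hx, hb1, zero_add]
    exact intervalIntegral_congr_ae_Ioo hJw hx
  have hwV : w ∈ clampedSpace hℓ.le := by
    rw [mem_clampedSpace_iff, inner_oneL2_left hℓ.le, inner_oneL2_left hℓ.le, hY1 ℓ hℓ', hb4,
      hY0 ℓ hℓ', hb3]
    exact ⟨rfl, rfl⟩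
  have hQac := hQ.1 0 (by norm_num)
  -- No constant from `q y'` appears, since `y'(0) = 0`.
  have hW1 : ∀ x ∈ Set.Icc 0 ℓ, W 1 x = W 1 0 + Q 0 x := fun x hx => by
    rw [(hW.1 1 (by norm_num)).2 x hx, hQac.2 x hx, intervalIntegral_congr_ae_Ioo hWQ hx, hQ0 0,
      hb2, mul_zero, zero_add]
  set z := mulOp hq (volterra hℓ.le w) with hz
  have hzQ : z =ᵐ[intervalMeasure ℓ] Q 0 := by
    filter_upwards [coeFn_mulOp hq (volterra hℓ.le w), hJw] with x h3 h4
    rw [h3, h4, hQ0]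
  have hσw : mulOp hσ w = W 0 0 • oneL2 ℓ + W 1 0 • volterra hℓ.le (oneL2 ℓ) +
      volterra hℓ.le z := by
    refine Lp.ext ?_
    filter_upwards [coeFn_mulOp hσ w, hwY, ae_restrict_mem measurableSet_Ioo,
      Lp.coeFn_add (W 0 0 • oneL2 ℓ + W 1 0 • volterra hℓ.le (oneL2 ℓ)) (volterra hℓ.le z),
      Lp.coeFn_add (W 0 0 • oneL2 ℓ) (W 1 0 • volterra hℓ.le (oneL2 ℓ)),
      Lp.coeFn_smul (W 0 0) (oneL2 ℓ), Lp.coeFn_smul (W 1 0) (volterra hℓ.le (oneL2 ℓ)),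
      coeFn_oneL2 (ℓ := ℓ), coeFn_volterra hℓ.le (oneL2 ℓ), coeFn_volterra hℓ.le z]
      with x e0 e1 hx e2 e3 e4 e5 e6 e7 e8
    have hx' := Set.Ioo_subset_Icc_self hx
    rw [e0, e1, ← hW0, e2, Pi.add_apply, e3, Pi.add_apply, e4, e5, Pi.smul_apply, Pi.smul_apply,
      e6, e7, e8, smul_eq_mul, smul_eq_mul, mul_one, intervalIntegral_congr_ae_Ioo hzQ hx',
      intervalIntegral_congr_ae_Ioo coeFn_oneL2 hx', (hW.1 0 (by norm_num)).2 x hx']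
    have hint : IntervalIntegrable (Q 0) volume 0 x := intervalIntegrable_of_integrableOn_Ioo
      (hQ.2 0 (by norm_num)).integrableOn_Ioo h0' hx'
    have : ∫ t in (0 : ℝ)..x, W 1 t = ∫ t in (0 : ℝ)..x, (W 1 0 + Q 0 t) := by
      refine intervalIntegral.integral_congr fun t ht => ?_
      rw [Set.uIcc_of_le hx'.1] at ht
      exact hW1 t ⟨ht.1, ht.2.trans hx'.2⟩
    rw [this, intervalIntegral.integral_add intervalIntegrable_const hint]
    simp only [intervalIntegral.integral_const, Complex.real_smul]
    ring
  have hBw : energyOp hℓ.le hσ hq w = (W 0 0 + W 1 0 * inner ℂ (oneL2 ℓ) (oneL2 ℓ) +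
      inner ℂ (oneL2 ℓ) z) • oneL2 ℓ +
      (-W 1 0) • ContinuousLinearMap.adjoint (volterra hℓ.le) (oneL2 ℓ) := by
    rw [energyOp_apply, hσw, ← hz, adjoint_volterra_apply, adjoint_volterra_apply]
    module
  have hwB : inner ℂ w (energyOp hℓ.le hσ hq w) = 0 := by
    refine (Submodule.mem_orthogonal' _ _).1 hwV _ ?_
    rw [hBw]
    exact Submodule.mem_span_pair.2 ⟨_, _, rfl⟩
  have hw0 : w = 0 := by
    have := le_re_inner_energyOp hℓ.le hσ hq hσle hq₀ w
    rw [hwB, Complex.zero_re] at this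
    have h3 : ‖w‖ ^ 2 ≤ 0 := nonpos_of_mul_nonpos_right this hσ₀
    exact norm_eq_zero.1 (pow_eq_zero_iff two_ne_zero |>.1 (le_antisymm h3 (by positivity)))
  refine Lp.ext ?_
  filter_upwards [h1, weightMeasure_absolutelyContinuous.ae_le (ae_restrict_mem measurableSet_Ioo),
    Lp.coeFn_zero ℂ 2 (weightMeasure ℓ ρ)] with x h3 hx h4
  rw [h4]
  refine h3.trans ?_
  have hx' := Set.Ioo_subset_Icc_self hx
  rw [← hY0 x hx', hw0, map_zero, intervalIntegral_congr_ae_Ioo (Lp.coeFn_zero ℂ 2 _) hx']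
  simp

/-- Zero propagates along the jets: a continuous representative vanishing almost everywhere vanishes
on `[0, ℓ]`, and so its derivative vanishes almost everywhere. This gives both the single-valuedness
of the graph and the injectivity of `K`. -/
theorem clampedGraph_snd_eq_zero (hℓ : 0 < ℓ) (hρ : ContinuousOn ρ (Set.Icc 0 ℓ))
    (hρpos : ∀ x ∈ Set.Icc 0 ℓ, 0 < ρ x) {v : WeightedL2 ℓ ρ}
    (h : (0, v) ∈ clampedGraph ℓ ρ σ q) : v = 0 := by
  obtain ⟨Y, W, Q, hY, -, ⟨hW, hW0⟩, ⟨hQ, hQ0⟩, h1, h2⟩ := h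
  have hac := absolutelyContinuous_weightMeasure hρ hρpos
  have e0 : Set.EqOn (Y 0) 0 (Set.Icc 0 ℓ) := by
    refine eqOn_zero_of_ae_eq_zero ((hY.1 0 (by norm_num)).continuousOn hℓ.le) hℓ ?_
    filter_upwards [hac.ae_le h1, hac.ae_le (Lp.coeFn_zero ℂ 2 (weightMeasure ℓ ρ))] with x h3 h4
    rw [← h3]
    exact h4
  have e1 : Set.EqOn (Y 1) 0 (Set.Icc 0 ℓ) :=
    eqOn_zero_of_ae_eq_zero ((hY.1 1 (by norm_num)).continuousOn hℓ.le) hℓ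
      ((hY.1 0 (by norm_num)).ae_eq_zero hℓ e0)
  have e2 : Set.EqOn (Y 2) 0 (Set.Icc 0 ℓ) :=
    eqOn_zero_of_ae_eq_zero ((hY.1 2 (by norm_num)).continuousOn hℓ.le) hℓ
      ((hY.1 1 (by norm_num)).ae_eq_zero hℓ e1)
  have w0 : Set.EqOn (W 0) 0 (Set.Icc 0 ℓ) := fun x hx => by
    rw [hW0, e2 hx]
    exact mul_zero _
  have w1 : Set.EqOn (W 1) 0 (Set.Icc 0 ℓ) :=
    eqOn_zero_of_ae_eq_zero ((hW.1 1 (by norm_num)).continuousOn hℓ.le) hℓ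
      ((hW.1 0 (by norm_num)).ae_eq_zero hℓ w0)
  have w2 := (hW.1 1 (by norm_num)).ae_eq_zero hℓ w1
  have q0 : Set.EqOn (Q 0) 0 (Set.Icc 0 ℓ) := fun x hx => by
    rw [hQ0, e1 hx]
    exact mul_zero _
  have q1 := (hQ.1 0 (by norm_num)).ae_eq_zero hℓ q0
  refine Lp.ext ?_
  filter_upwards [h2, weightMeasure_absolutelyContinuous.ae_le w2,
    weightMeasure_absolutelyContinuous.ae_le q1,
    Lp.coeFn_zero ℂ 2 (weightMeasure ℓ ρ)] with x h3 h4 h5 h6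
  rw [h6]
  refine h3.trans ?_
  rw [h4, h5]
  simp

end ClampedGraph

/-! ### Eigenbases of compact operators -/

section CompactEigenbasis

/-- Order `ι` by `lam`, breaking ties with an injection into `ℕ`. Initial segments are finite, so
this infinite linear order is isomorphic to `ℕ`. -/
theorem exists_equiv_nat_monotone {ι : Type*} [Infinite ι] (lam : ι → ℝ)
    (hfin : ∀ C, {i | lam i ≤ C}.Finite) : ∃ e : ℕ ≃ ι, Monotone (lam ∘ e) := by
  have hcount : Countable ι := by
    rw [← Set.countable_univ_iff]
    have : (Set.univ : Set ι) = ⋃ n : ℕ, {i | lam i ≤ n} := by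
      ext i
      simpa using exists_nat_ge (lam i)
    rw [this]
    exact Set.countable_iUnion fun n => (hfin n).countable
  obtain ⟨g, hg⟩ := exists_injective_nat ι
  let φ : ι → ℝ ×ₗ ℕ := fun i => toLex (lam i, g i)
  have hφ : Function.Injective φ := fun i j h => hg (congrArg (fun p => (ofLex p).2) h)
  let : LinearOrder ι := LinearOrder.lift' φ hφ
  have hlam : ∀ {i j : ι}, i ≤ j → lam i ≤ lam j := fun {i j} h => by
    have h' : φ i ≤ φ j := h
    rcases Prod.Lex.toLex_le_toLex.1 h' with h1 | h1
    · exact h1.le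
    · exact h1.1.le
  have hIic : ∀ i : ι, (Set.Iic i).Finite := fun i => (hfin (lam i)).subset fun j hj => hlam hj
  let : LocallyFiniteOrder ι := LocallyFiniteOrder.ofFiniteIcc fun a b =>
    (hIic b).subset Set.Icc_subset_Iic_self
  have : NoMaxOrder ι := ⟨fun i => by
    obtain ⟨j, hj⟩ := (hIic i).exists_notMem
    exact ⟨j, not_le.1 hj⟩⟩
  have i₀ : ι := Classical.arbitrary ι
  obtain ⟨m, hm, hmin⟩ := (hIic i₀).exists_minimal ⟨i₀, Set.mem_Iic.2 le_rfl⟩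
  let : OrderBot ι :=
    { bot := m
      bot_le := fun j => by
        rcases le_total m j with h | h
        · exact h
        · exact hmin (le_trans h hm) h }
  let := LinearLocallyFiniteOrder.succOrder ι
  let := LinearLocallyFiniteOrder.predOrder ι
  let e : ι ≃o ℕ := orderIsoNatOfLinearSuccPredArch
  exact ⟨e.symm.toEquiv, fun a b hab => hlam (e.symm.monotone hab)⟩

variable {H : Type*} [NormedAddCommGroup H] [InnerProductSpace ℂ H]

theorem norm_sub_sq_of_orthonormal_smul {ι : Type*} {v : ι → H} (hv : Orthonormal ℂ v) {i j : ι}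
    (hij : i ≠ j) (a b : ℝ) : ‖(a : ℂ) • v i - (b : ℂ) • v j‖ ^ 2 = a ^ 2 + b ^ 2 := by
  have h : inner ℂ ((a : ℂ) • v i) ((b : ℂ) • v j) = 0 := by
    rw [inner_smul_left, inner_smul_right, hv.2 hij, mul_zero, mul_zero]
  rw [norm_sub_sq (𝕜 := ℂ), h, map_zero, mul_zero, sub_zero, norm_smul, norm_smul, hv.1, hv.1]
  simp

/-- Distinct `K (v i)` with `μ i ≥ c` are at distance at least `c` by orthogonality, so an infinite
family in the compact closure would have no Cauchy subsequence. -/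
theorem finite_of_orthonormal_eigenvectors {K : H →L[ℂ] H} (hK : IsCompactOperator K) {ι : Type*}
    {v : ι → H} (hv : Orthonormal ℂ v) {μ : ι → ℝ} (hμ : ∀ i, K (v i) = (μ i : ℂ) • v i) {c : ℝ}
    (hc : 0 < c) : {i | c ≤ μ i}.Finite := by
  by_contra hinf
  have hinf : {i | c ≤ μ i}.Infinite := hinf
  let e := hinf.natEmbedding
  have hcomp := hK.isCompact_closure_image_closedBall (𝕜₁ := ℂ) 1
  have hmem : ∀ n, K (v (e n)) ∈ closure (K '' Metric.closedBall 0 1) := fun n =>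
    subset_closure ⟨v (e n), by simp [hv.1], rfl⟩
  obtain ⟨a, -, φ, hφ, hlim⟩ := hcomp.tendsto_subseq hmem
  have hC := hlim.cauchySeq
  obtain ⟨N, hN⟩ := Metric.cauchySeq_iff'.1 hC c hc
  have h := hN (N + 1) (Nat.le_succ N)
  have hne : (e (φ (N + 1)) : ι) ≠ e (φ N) := fun h' => by
    have := hφ.injective (e.injective (Subtype.ext h'))
    omega
  simp only [Function.comp_apply, dist_eq_norm, hμ] at h
  have h2 := norm_sub_sq_of_orthonormal_smul hv hne (μ (e (φ (N + 1)))) (μ (e (φ N)))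
  have h3 : c ≤ μ (e (φ (N + 1))) := (e (φ (N + 1))).2
  have h4 := norm_nonneg ((μ (e (φ (N + 1))) : ℂ) • v (e (φ (N + 1))) -
    (μ (e (φ N)) : ℂ) • v (e (φ N)))
  nlinarith [sq_nonneg (μ (e (φ N)))]

theorem exists_eigenbasis_of_compact [CompleteSpace H] {K : H →L[ℂ] H} (hK : IsCompactOperator K)
    (hsymm : K.IsSymmetric) (hnonneg : ∀ f, 0 ≤ (inner ℂ f (K f)).re)
    (hinj : ∀ f, K f = 0 → f = 0) (hdim : ¬ FiniteDimensional ℂ H) :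
    ∃ (lam : ℕ → ℝ) (Φ : HilbertBasis ℕ ℂ H), Monotone lam ∧ (∀ n, 0 < lam n) ∧
      Filter.Tendsto lam Filter.atTop Filter.atTop ∧
      ∀ n, K (Φ n) = ((lam n)⁻¹ : ℂ) • Φ n := by
  let E : ℂ → Submodule ℂ H := fun μ => Module.End.eigenspace (K : H →ₗ[ℂ] H) μ
  have hfd : ∀ μ : {μ : ℂ // μ ≠ 0}, FiniteDimensional ℂ (E μ) := fun μ =>
    ContinuousLinearMap.finite_dimensional_eigenspace hK μ.1 μ.2
  let b : ∀ μ : {μ : ℂ // μ ≠ 0}, OrthonormalBasis (Fin (Module.finrank ℂ (E μ))) ℂ (E μ) :=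
    fun μ => stdOrthonormalBasis ℂ (E μ)
  let ι := Σ μ : {μ : ℂ // μ ≠ 0}, Fin (Module.finrank ℂ (E μ))
  let v : ι → H := fun p => (b p.1 p.2 : H)
  have hfam : OrthogonalFamily ℂ (fun μ : {μ : ℂ // μ ≠ 0} => E μ) fun μ => (E μ).subtypeₗᵢ :=
    hsymm.orthogonalFamily_eigenspaces.comp Subtype.val_injective
  have hv : Orthonormal ℂ v := hfam.orthonormal_sigma_orthonormal fun μ => (b μ).orthonormal
  have hKv : ∀ p : ι, K (v p) = (p.1 : ℂ) • v p := fun p =>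
    Module.End.mem_eigenspace_iff.1 (b p.1 p.2).2
  -- The family `v` omits the eigenvalue `0`; injectivity of `K` means that nothing is lost.
  have hcompl : (Submodule.span ℂ (Set.range v))ᗮ = ⊥ := by
    rw [eq_bot_iff, ← ContinuousLinearMap.orthogonalComplement_iSup_eigenspaces_eq_bot hK hsymm]
    refine Submodule.orthogonal_le (iSup_le fun μ => ?_)
    by_cases hμ : μ = 0
    · intro x hx
      have hx0 : K x = 0 := by
        have := Module.End.mem_eigenspace_iff.1 hx
        simpa [hμ] using this
      rw [hinj x hx0]
      exact Submodule.zero_mem _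
    · intro x hx
      have h := (b ⟨μ, hμ⟩).sum_repr ⟨x, hx⟩
      have h' : ((∑ i, (b ⟨μ, hμ⟩).repr ⟨x, hx⟩ i • b ⟨μ, hμ⟩ i : E μ) : H) = x :=
        congrArg Subtype.val h
      rw [← h', Submodule.coe_sum]
      refine Submodule.sum_mem _ fun i _ => ?_
      exact Submodule.smul_mem _ _ (Submodule.subset_span ⟨⟨⟨μ, hμ⟩, i⟩, rfl⟩)
  have hreal : ∀ p : ι, ((p.1 : ℂ).re : ℂ) = p.1 ∧ 0 < (p.1 : ℂ).re := fun p => by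
    have h1 : inner ℂ (v p) (K (v p)) = (p.1 : ℂ) := by
      rw [hKv, inner_smul_right, inner_self_eq_norm_sq_to_K, hv.1]
      simp
    have h2 : (starRingEnd ℂ) (p.1 : ℂ) = p.1 := by
      rw [← h1, inner_conj_symm]
      exact hsymm _ _
    have h3 := Complex.conj_eq_iff_re.1 h2
    refine ⟨h3, lt_of_le_of_ne (h1 ▸ hnonneg (v p)) fun h0 => p.1.2 ?_⟩
    rw [← h3, ← h0, Complex.ofReal_zero]
  let lam : ι → ℝ := fun p => ((p.1 : ℂ).re)⁻¹
  have hlampos : ∀ p, 0 < lam p := fun p => inv_pos.2 (hreal p).2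
  have hfin : ∀ C, {p | lam p ≤ C}.Finite := fun C => by
    have hC : 0 < max C 1 := lt_max_of_lt_right one_pos
    refine (finite_of_orthonormal_eigenvectors hK hv (μ := fun p => (p.1 : ℂ).re)
      (fun p => by rw [hKv, (hreal p).1]) (inv_pos.2 hC)).subset fun p hp => ?_
    have hp' : lam p ≤ max C 1 := le_trans hp (le_max_left _ _)
    exact (inv_le_comm₀ (hreal p).2 hC).1 hp'
  have : Infinite ι := by
    by_contra hι
    have : Finite ι := not_infinite_iff_finite.1 hι
    apply hdim
    have hfs : FiniteDimensional ℂ (Submodule.span ℂ (Set.range v)) :=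
      FiniteDimensional.span_of_finite ℂ (Set.finite_range v)
    have htop : Submodule.span ℂ (Set.range v) = ⊤ := by
      rw [← Submodule.orthogonal_orthogonal (Submodule.span ℂ (Set.range v)), hcompl,
        Submodule.bot_orthogonal_eq_top]
    rw [htop] at hfs
    exact Module.finite_def.2 (Module.Finite.iff_fg.1 hfs)
  obtain ⟨e, he⟩ := exists_equiv_nat_monotone lam hfin
  have hrange : Set.range (v ∘ e) = Set.range v := e.surjective.range_comp v
  refine ⟨lam ∘ e, HilbertBasis.mkOfOrthogonalEqBot (hv.comp e e.injective) (by rw [hrange, hcompl]),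
    he, fun n => hlampos _, ?_, fun n => ?_⟩
  · rw [Filter.tendsto_atTop]
    intro C
    have h1 : {n | lam (e n) ≤ C}.Finite := (hfin C).preimage e.injective.injOn
    have h2 := h1.compl_mem_cofinite
    rw [Nat.cofinite_eq_atTop] at h2
    filter_upwards [h2] with n hn
    exact le_of_not_ge hn
  · rw [HilbertBasis.coe_mkOfOrthogonalEqBot, Function.comp_apply, hKv]
    congr 1
    rw [Function.comp_apply, Complex.ofReal_inv, inv_inv, (hreal _).1]

end CompactEigenbasis

/-! ### Hilbert basis expansions -/

section HilbertBasisExpansion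

variable {H : Type*} [NormedAddCommGroup H] [InnerProductSpace ℂ H] {ι : Type*}

theorem HilbertBasis.hasSum_norm_sq_inner (Φ : HilbertBasis ι ℂ H) (x : H) :
    HasSum (fun i => ‖inner ℂ (Φ i) x‖ ^ 2) (‖x‖ ^ 2) := by
  have h := Φ.hasSum_inner_mul_inner x x
  have h' := Complex.hasSum_re h
  convert h' using 1
  · ext i
    rw [← inner_conj_symm, Complex.mul_conj, Complex.ofReal_re, Complex.normSq_eq_norm_sq,
      Complex.norm_conj]
  · rw [← RCLike.re_eq_complex_re, inner_self_eq_norm_sq]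

theorem HilbertBasis.ext_inner (Φ : HilbertBasis ι ℂ H) {x y : H}
    (h : ∀ i, inner ℂ (Φ i) x = inner ℂ (Φ i) y) : x = y := by
  apply Φ.repr.injective
  ext i
  rw [Φ.repr_apply_apply, Φ.repr_apply_apply, h]

theorem HilbertBasis.norm_eq_of_norm_inner_eq (Φ : HilbertBasis ι ℂ H) {x y : H}
    (h : ∀ i, ‖inner ℂ (Φ i) x‖ = ‖inner ℂ (Φ i) y‖) : ‖x‖ = ‖y‖ := by
  have h1 := Φ.hasSum_norm_sq_inner x
  simp only [h] at h1
  exact (sq_eq_sq₀ (norm_nonneg _) (norm_nonneg _)).1 (h1.unique (Φ.hasSum_norm_sq_inner y))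

/-- Coefficients dominated by those of a vector are the coefficients of a vector. -/
theorem HilbertBasis.exists_inner_eq (Φ : HilbertBasis ι ℂ H) {a : ι → ℂ} {g : H} {C : ℝ}
    (h : ∀ i, ‖a i‖ ≤ C * ‖inner ℂ (Φ i) g‖) : ∃ x, ∀ i, inner ℂ (Φ i) x = a i := by
  have hmem : Memℓp a 2 := by
    refine memℓp_gen ?_
    have hs := (Φ.hasSum_norm_sq_inner g).summable.mul_left (C ^ 2)
    refine hs.of_nonneg_of_le (fun i => by positivity) fun i => ?_
    rw [ENNReal.toReal_ofNat, Real.rpow_two, ← mul_pow]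
    gcongr
    exact h i
  refine ⟨Φ.repr.symm ⟨a, hmem⟩, fun i => ?_⟩
  rw [← Φ.repr_apply_apply, LinearIsometryEquiv.apply_symm_apply]

theorem HilbertBasis.summable_norm_inner_mul_inner (Φ : HilbertBasis ι ℂ H) (x y : H) :
    Summable fun i => ‖inner ℂ (Φ i) x‖ * ‖inner ℂ (Φ i) y‖ := by
  have h := (Φ.summable_inner_mul_inner x y).norm
  refine h.congr fun i => ?_
  rw [norm_mul, norm_inner_symm]

end HilbertBasisExpansion

/-! ### Symmetric operators with an eigenbasis -/

section SpectralScale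

variable {H : Type*} [NormedAddCommGroup H] [InnerProductSpace ℂ H]

/-- The operator is symmetric on its domain. -/
def LinearPMap.IsSymm (A : H →ₗ.[ℂ] H) : Prop :=
  ∀ u v : A.domain, inner ℂ (A u) (v : H) = inner ℂ (u : H) (A v)

variable {A : H →ₗ.[ℂ] H}

theorem LinearPMap.IsSymm.inner_apply_of_mem_eigSpace (hA : A.IsSymm) {r : ℝ} {e : H}
    (he : e ∈ eigSpace A r) (u : A.domain) : inner ℂ e (A u) = r * inner ℂ e (u : H) := by
  obtain ⟨h, h'⟩ := he
  rw [← hA ⟨e, h⟩ u, h', inner_smul_left, Complex.conj_ofReal]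

theorem LinearPMap.IsSymm.inner_eq_zero_of_ne (hA : A.IsSymm) {r s : ℝ} (hrs : r ≠ s) {u v : H}
    (hu : u ∈ eigSpace A r) (hv : v ∈ eigSpace A s) : inner ℂ u v = 0 := by
  obtain ⟨h, h'⟩ := id hv
  have h1 := hA.inner_apply_of_mem_eigSpace hu ⟨v, h⟩
  rw [h', inner_smul_right] at h1
  have h2 : ((s : ℂ) - r) * inner ℂ u v = 0 := by
    rw [sub_mul, h1, sub_self]
  refine (mul_eq_zero.1 h2).resolve_left (sub_ne_zero.2 ?_)
  exact_mod_cast hrs.symm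

/-- Otherwise `u` would be orthogonal to the whole basis. This transfers positivity of the
eigenvalues from one eigenbasis to any other. -/
theorem eigenvalue_mem_range (hA : A.IsSymm) {lam : ℕ → ℝ} {Φ : HilbertBasis ℕ ℂ H}
    (hΦ : ∀ n, Φ n ∈ eigSpace A (lam n)) {r : ℝ} {u : H} (hu : u ∈ eigSpace A r) (hu0 : u ≠ 0) :
    ∃ n, lam n = r := by
  by_contra! h
  exact hu0 (Φ.ext_inner fun n => by
    rw [hA.inner_eq_zero_of_ne (h n) (hΦ n) hu, inner_zero_right])

variable [CompleteSpace H]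

theorem eigProj_of_mem_eigSpace (hA : A.IsSymm) {r s : ℝ} {e : H} (he : e ∈ eigSpace A s) :
    eigProj A r e = if r = s then e else 0 := by
  split_ifs with h
  · subst h
    exact Submodule.starProjection_eq_self_iff.2 (Submodule.le_topologicalClosure _ he)
  · refine (Submodule.starProjection_apply_eq_zero_iff _).2 ?_
    rw [Submodule.orthogonal_closure, Submodule.mem_orthogonal]
    intro u hu
    exact hA.inner_eq_zero_of_ne h hu he

theorem inner_eigProj_of_mem_eigSpace (hA : A.IsSymm) {r s : ℝ} {e : H} (he : e ∈ eigSpace A s)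
    (u : H) : inner ℂ e (eigProj A r u) = if r = s then inner ℂ e u else 0 := by
  have h : inner ℂ e (eigProj A r u) = inner ℂ (eigProj A r e) u :=
    (Submodule.inner_starProjection_left_eq_right _ _ _).symm
  rw [h, eigProj_of_mem_eigSpace hA he]
  split_ifs <;> simp

theorem hasSum_eigProj_of_mem_eigSpace (hA : A.IsSymm) (θ : ℝ) {s : ℝ} {e : H}
    (he : e ∈ eigSpace A s) :
    HasSum (fun r : ℝ => ((r ^ θ : ℝ) : ℂ) • eigProj A r e) (((s ^ θ : ℝ) : ℂ) • e) := by
  convert hasSum_single s fun r hr => ?_ using 1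
  · rw [eigProj_of_mem_eigSpace hA he, if_pos rfl]
  · rw [eigProj_of_mem_eigSpace hA he, if_neg hr, smul_zero]

theorem mem_opPow_domain_of_mem_eigSpace (hA : A.IsSymm) (θ : ℝ) {s : ℝ} {e : H}
    (he : e ∈ eigSpace A s) : e ∈ (opPow A θ).domain :=
  (hasSum_eigProj_of_mem_eigSpace hA θ he).summable

theorem opPow_apply_of_mem_eigSpace (hA : A.IsSymm) (θ : ℝ) {s : ℝ} {e : H}
    (he : e ∈ eigSpace A s) :
    opPow A θ ⟨e, mem_opPow_domain_of_mem_eigSpace hA θ he⟩ = ((s ^ θ : ℝ) : ℂ) • e :=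
  (hasSum_eigProj_of_mem_eigSpace hA θ he).tsum_eq

/-- Pairing the defining series with `e` leaves only the term `r = s`. -/
theorem inner_opPow (hA : A.IsSymm) (θ : ℝ) {s : ℝ} {e : H} (he : e ∈ eigSpace A s)
    (u : (opPow A θ).domain) :
    inner ℂ e (opPow A θ u) = ((s ^ θ : ℝ) : ℂ) * inner ℂ e (u : H) := by
  have h : HasSum (fun r : ℝ => ((r ^ θ : ℝ) : ℂ) • eigProj A r (u : H)) (opPow A θ u) :=
    Summable.hasSum u.2
  have h1 := (innerSL ℂ e).hasSum h
  have h2 : HasSum (fun r : ℝ => inner ℂ e (((r ^ θ : ℝ) : ℂ) • eigProj A r (u : H)))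
      (((s ^ θ : ℝ) : ℂ) * inner ℂ e (u : H)) := by
    convert hasSum_single s fun r hr => ?_ using 1
    · rw [inner_smul_right, inner_eigProj_of_mem_eigSpace hA he, if_pos rfl]
    · rw [inner_smul_right, inner_eigProj_of_mem_eigSpace hA he, if_neg hr, mul_zero]
  exact h1.unique h2

/-! ### The scale of spaces -/

/-- `A^θ` as an isometry of `D(A^θ)` with the norm `‖A^θ u‖`. -/
def preScaleIsometry (A : H →ₗ.[ℂ] H) (θ : ℝ) : PreScale A θ →ₗᵢ[ℂ] H :=
  { PreScale.pow A θ with norm_map' := fun _ => rfl }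

/-- The extension of `A^θ` to an isometry of `𝓗_θ` into `H`. -/
def scaleIsometry (A : H →ₗ.[ℂ] H) (θ : ℝ) : Scale A θ →ₗᵢ[ℂ] H :=
  let U : Scale A θ →L[ℂ] H :=
    (preScaleIsometry A θ).toContinuousLinearMap.extend UniformSpace.Completion.toComplL
  have hU : ∀ u : PreScale A θ, U u = PreScale.pow A θ u := fun u =>
    ContinuousLinearMap.extend_eq (preScaleIsometry A θ).toContinuousLinearMap
      (e := UniformSpace.Completion.toComplL) UniformSpace.Completion.denseRange_coe
      (UniformSpace.Completion.isUniformInducing_coe _) u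
  { U.toLinearMap with
    norm_map' := fun x => by
      change ‖U x‖ = ‖x‖
      induction x using UniformSpace.Completion.induction_on with
      | hp => exact isClosed_eq (U.continuous.norm) continuous_norm
      | ih u =>
        rw [hU, UniformSpace.Completion.norm_coe]
        rfl }

theorem scaleIsometry_coe (θ : ℝ) (u : PreScale A θ) :
    scaleIsometry A θ u = PreScale.pow A θ u :=
  ContinuousLinearMap.extend_eq (preScaleIsometry A θ).toContinuousLinearMap
    (e := UniformSpace.Completion.toComplL) UniformSpace.Completion.denseRange_coe
    (UniformSpace.Completion.isUniformInducing_coe _) u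

theorem scaleIsometry_toScale (hA : A.IsSymm) (θ : ℝ) {s : ℝ} {e : H} (he : e ∈ eigSpace A s)
    (h : e ∈ (opPow A θ).domain) :
    scaleIsometry A θ (toScale A θ e h) = ((s ^ θ : ℝ) : ℂ) • e :=
  (scaleIsometry_coe θ _).trans (opPow_apply_of_mem_eigSpace hA θ he)

variable {lam : ℕ → ℝ} {Φ : HilbertBasis ℕ ℂ H}

/-- The range is closed, being an isometric image of a complete space, and contains every `Φ n`
because `lam n ^ θ ≠ 0`. -/
theorem scaleIsometry_surjective (hA : A.IsSymm) (θ : ℝ) (hΦ : ∀ n, Φ n ∈ eigSpace A (lam n))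
    (hpos : ∀ n, 0 < lam n) : Function.Surjective (scaleIsometry A θ) := by
  have hclosed : IsClosed (LinearMap.range (scaleIsometry A θ).toLinearMap : Set H) := by
    rw [LinearMap.coe_range]
    exact (scaleIsometry A θ).isometry.isClosedEmbedding.isClosed_range
  have hspan : Submodule.span ℂ (Set.range Φ) ≤
      LinearMap.range (scaleIsometry A θ).toLinearMap := by
    rw [Submodule.span_le]
    rintro _ ⟨n, rfl⟩
    have hne : ((lam n ^ θ : ℝ) : ℂ) ≠ 0 := by
      exact_mod_cast (Real.rpow_pos_of_pos (hpos n) θ).ne'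
    refine ⟨((lam n ^ θ : ℝ) : ℂ)⁻¹ •
      toScale A θ (Φ n) (mem_opPow_domain_of_mem_eigSpace hA θ (hΦ n)), ?_⟩
    change scaleIsometry A θ _ = _
    rw [map_smul, scaleIsometry_toScale hA θ (hΦ n), inv_smul_smul₀ hne]
  have htop := Φ.dense_span
  have h2 := Submodule.topologicalClosure_minimal _ hspan hclosed
  rw [htop] at h2
  intro x
  exact h2 (Submodule.mem_top (x := x))

theorem hasSum_smul_toScale_iff (hA : A.IsSymm) (θ : ℝ) (hΦ : ∀ n, Φ n ∈ eigSpace A (lam n))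
    (hpos : ∀ n, 0 < lam n) (hdom : ∀ n, Φ n ∈ (opPow A θ).domain) (c : ℕ → ℂ) (x : Scale A θ) :
    HasSum (fun n => c n • toScale A θ (Φ n) (hdom n)) x ↔
      ∀ n, c n * ((lam n ^ θ : ℝ) : ℂ) = inner ℂ (Φ n) (scaleIsometry A θ x) := by
  have key : HasSum (fun n => c n • toScale A θ (Φ n) (hdom n)) x ↔
      HasSum (fun n => (c n * ((lam n ^ θ : ℝ) : ℂ)) • Φ n) (scaleIsometry A θ x) := by
    let e := LinearIsometryEquiv.ofSurjective (scaleIsometry A θ)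
      (scaleIsometry_surjective hA θ hΦ hpos)
    have := e.toContinuousLinearEquiv.hasSum
      (f := fun n => c n • toScale A θ (Φ n) (hdom n)) (L := .unconditional ℕ) (y := scaleIsometry A θ x)
    have he : ∀ z, e.toContinuousLinearEquiv z = scaleIsometry A θ z := fun z => rfl
    have hx : e.toContinuousLinearEquiv.symm (scaleIsometry A θ x) = x := by
      rw [← he, ContinuousLinearEquiv.symm_apply_apply]
    rw [hx] at this
    rw [← this]
    simp only [he, map_smul, scaleIsometry_toScale hA θ (hΦ _), smul_smul]
  rw [key]
  constructor
  · intro h n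
    have h1 := (innerSL ℂ (Φ n)).hasSum h
    have h2 : HasSum (fun m => inner ℂ (Φ n) ((c m * ((lam m ^ θ : ℝ) : ℂ)) • Φ m))
        (c n * ((lam n ^ θ : ℝ) : ℂ)) := by
      convert hasSum_single n fun m hm => ?_ using 1
      · rw [inner_smul_right, inner_self_eq_norm_sq_to_K, Φ.orthonormal.1]
        simp
      · rw [inner_smul_right, Φ.orthonormal.2 hm.symm, mul_zero]
    exact h2.unique h1
  · intro h
    simp only [h]
    simpa only [Φ.repr_apply_apply] using Φ.hasSum_repr (scaleIsometry A θ x)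

end SpectralScale

/-! ### Smooth vectors -/

section Evolution

variable {H : Type*} [NormedAddCommGroup H] [InnerProductSpace ℂ H] {A : H →ₗ.[ℂ] H}
  {lam : ℕ → ℝ} {Φ : HilbertBasis ℕ ℂ H}

theorem mem_smoothVectors_of_mem_eigSpace {r : ℝ} {e : H} (he : e ∈ eigSpace A r) :
    e ∈ smoothVectors A := by
  refine ⟨fun k => ((r : ℂ) ^ k) • e, by simp, fun k => ?_⟩
  obtain ⟨h, h'⟩ := (eigSpace A r).smul_mem ((r : ℂ) ^ k) he
  refine ⟨h, h'.trans ?_⟩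
  rw [smul_smul, ← pow_succ']

theorem apply_mem_smoothVectors {φ : H} (hφ : φ ∈ smoothVectors A) :
    A ⟨φ, smoothVectors_subset_domain A hφ⟩ ∈ smoothVectors A := by
  obtain ⟨f, rfl, hf⟩ := id hφ
  obtain ⟨h, h'⟩ := hf 0
  exact ⟨fun k => f (k + 1), h'.symm, fun k => hf (k + 1)⟩

/-- The vector `A^(-θ) φ` for smooth `φ`. -/
theorem exists_inner_eq_rpow_neg_mul (hA : A.IsSymm) (hΦ : ∀ n, Φ n ∈ eigSpace A (lam n))
    (hmono : Monotone lam) (hpos : ∀ n, 0 < lam n) (θ : ℝ) {φ : H} (hφ : φ ∈ smoothVectors A) :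
    ∃ ψ : H, ∀ n, inner ℂ (Φ n) ψ = ((lam n ^ (-θ) : ℝ) : ℂ) * inner ℂ (Φ n) φ := by
  obtain ⟨f, rfl, hf⟩ := hφ
  have hcoeff : ∀ k n, inner ℂ (Φ n) (f k) = (lam n : ℂ) ^ k * inner ℂ (Φ n) (f 0) := by
    intro k n
    induction k with
    | zero => simp
    | succ k ih =>
      obtain ⟨h, h'⟩ := hf k
      rw [← h', hA.inner_apply_of_mem_eigSpace (hΦ n), ih, pow_succ']
      ring
  -- With an integer `k ≥ -θ`, the coefficients of `A^k φ` dominate those of `A^(-θ) φ`. Dividing by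
  -- `lam 0` makes the bases at least `1`, so that the powers can be compared by exponent.
  obtain ⟨k, hk⟩ := exists_nat_ge (-θ)
  refine Φ.exists_inner_eq (g := f k) (C := lam 0 ^ (-θ) * (lam 0 ^ k)⁻¹) fun n => ?_
  have h0 := hpos 0
  have hle : 1 ≤ lam n / lam 0 := (one_le_div h0).2 (hmono (Nat.zero_le n))
  have h1 : lam n ^ (-θ) ≤ lam 0 ^ (-θ) * (lam 0 ^ k)⁻¹ * lam n ^ k := by
    have h2 : lam n = lam 0 * (lam n / lam 0) := by field_simp
    have h3 : (lam n / lam 0) ^ (-θ) ≤ (lam n / lam 0) ^ k := by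
      rw [← Real.rpow_natCast]
      exact Real.rpow_le_rpow_of_exponent_le hle hk
    calc lam n ^ (-θ) = lam 0 ^ (-θ) * (lam n / lam 0) ^ (-θ) := by
          conv_lhs => rw [h2]
          rw [Real.mul_rpow h0.le (by positivity)]
      _ ≤ lam 0 ^ (-θ) * (lam n / lam 0) ^ k := by gcongr
      _ = _ := by rw [div_pow]; ring
  rw [hcoeff k n, norm_mul, norm_mul, norm_pow, Complex.norm_real, Complex.norm_real,
    Real.norm_of_nonneg (hpos n).le, Real.norm_of_nonneg (Real.rpow_nonneg (hpos n).le _),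
    ← mul_assoc]
  gcongr

/-! ### The unitary group -/

theorem norm_exp_I_mul_ofReal_mul_ofReal (r t : ℝ) :
    ‖Complex.exp (Complex.I * r * t)‖ = 1 := by
  have h : Complex.I * r * t = ((r * t : ℝ) : ℂ) * Complex.I := by push_cast; ring
  rw [h, Complex.norm_exp_ofReal_mul_I]

/-- Unimodular factors preserve square summability. Continuity is dominated convergence in
Parseval's sum, each term being at most `4 ‖⟪Φ n, h⟫‖²`. -/
theorem exists_unitary_orbit (Φ : HilbertBasis ℕ ℂ H) (lam : ℕ → ℝ) (h : H) :
    ∃ w : ℝ → H, Continuous w ∧ ∀ t n, inner ℂ (Φ n) (w t) =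
      Complex.exp (Complex.I * lam n * t) * inner ℂ (Φ n) h := by
  have hnorm n t := norm_exp_I_mul_ofReal_mul_ofReal (lam n) t
  have hex : ∀ t : ℝ, ∃ x, ∀ n, inner ℂ (Φ n) x =
      Complex.exp (Complex.I * lam n * t) * inner ℂ (Φ n) h := fun t =>
    Φ.exists_inner_eq (g := h) (C := 1) fun n => by rw [norm_mul, hnorm]
  choose w hw using hex
  refine ⟨w, continuous_iff_continuousAt.2 fun t => ?_, hw⟩
  rw [ContinuousAt, tendsto_iff_norm_sub_tendsto_zero]
  have hsq : Filter.Tendsto (fun s => ‖w s - w t‖ ^ 2) (nhds t) (nhds 0) := by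
    have hform : ∀ s, ‖w s - w t‖ ^ 2 = ∑' n, ‖(Complex.exp (Complex.I * lam n * s) -
        Complex.exp (Complex.I * lam n * t)) * inner ℂ (Φ n) h‖ ^ 2 := fun s => by
      rw [← (Φ.hasSum_norm_sq_inner (w s - w t)).tsum_eq]
      refine tsum_congr fun n => ?_
      rw [inner_sub_right, hw, hw, sub_mul]
    simp only [hform]
    rw [← tsum_zero (α := ℝ) (β := ℕ)]
    refine tendsto_tsum_of_dominated_convergence
      (bound := fun n => 4 * ‖inner ℂ (Φ n) h‖ ^ 2)
      ((Φ.hasSum_norm_sq_inner h).summable.mul_left 4) (fun n => ?_) (.of_forall fun s n => ?_)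
    · have hc : Continuous fun s : ℝ => ‖(Complex.exp (Complex.I * lam n * s) -
          Complex.exp (Complex.I * lam n * t)) * inner ℂ (Φ n) h‖ ^ 2 := by fun_prop
      have := hc.tendsto t
      simpa using this
    · rw [norm_pow, norm_norm, norm_mul, mul_pow]
      have h2 : ‖Complex.exp (Complex.I * lam n * s) - Complex.exp (Complex.I * lam n * t)‖ ≤ 2 := by
        refine (norm_sub_le _ _).trans ?_
        rw [hnorm, hnorm]
        norm_num
      gcongr
      calc _ ≤ (2 : ℝ) ^ 2 := by gcongr
        _ = 4 := by norm_num
  have := hsq.sqrt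
  simpa using this

/-- Here `ψ'` plays the role of `A ψ`. The differentiated series is dominated, uniformly in time, by
the summable products of the coefficients of `ψ'` and `h`. -/
theorem hasDerivAt_inner_orbit {w : ℝ → H} {h ψ ψ' : H}
    (hw : ∀ t n, inner ℂ (Φ n) (w t) = Complex.exp (Complex.I * lam n * (t : ℝ)) * inner ℂ (Φ n) h)
    (hψ : ∀ n, inner ℂ (Φ n) ψ' = (lam n : ℂ) * inner ℂ (Φ n) ψ) (t : ℝ) :
    HasDerivAt (fun s => inner ℂ ψ (w s)) (Complex.I * inner ℂ ψ' (w t)) t := by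
  have hnorm n t := norm_exp_I_mul_ofReal_mul_ofReal (lam n) t
  have e1 : (fun s => inner ℂ ψ (w s)) = fun s : ℝ => ∑' n, inner ℂ ψ (Φ n) *
      (Complex.exp (Complex.I * lam n * s) * inner ℂ (Φ n) h) := by
    ext s
    rw [← (Φ.hasSum_inner_mul_inner ψ (w s)).tsum_eq]
    simp only [hw]
  have hψ2 : ∀ n, inner ℂ ψ' (Φ n) = (lam n : ℂ) * inner ℂ ψ (Φ n) := fun n => by
    rw [← inner_conj_symm, hψ, map_mul, Complex.conj_ofReal, inner_conj_symm]
  have e2 : Complex.I * inner ℂ ψ' (w t) = ∑' n, inner ℂ ψ (Φ n) *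
      (Complex.exp (Complex.I * lam n * t) * (Complex.I * lam n) * inner ℂ (Φ n) h) := by
    rw [← (Φ.hasSum_inner_mul_inner ψ' (w t)).tsum_eq, ← tsum_mul_left]
    refine tsum_congr fun n => ?_
    rw [hψ2, hw]
    ring
  rw [e1, e2]
  refine hasDerivAt_tsum (u := fun n => ‖inner ℂ (Φ n) ψ'‖ * ‖inner ℂ (Φ n) h‖) (y₀ := 0)
    (g := fun n (s : ℝ) => inner ℂ ψ (Φ n) * (Complex.exp (Complex.I * lam n * s) *
      inner ℂ (Φ n) h))
    (g' := fun n (s : ℝ) => inner ℂ ψ (Φ n) * (Complex.exp (Complex.I * lam n * s) *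
      (Complex.I * lam n) * inner ℂ (Φ n) h))
    (Φ.summable_norm_inner_mul_inner ψ' h) (fun n s => ?_) (fun n s => ?_) ?_ t
  · have h1 : HasDerivAt (fun s : ℝ => Complex.I * lam n * (s : ℂ)) (Complex.I * lam n) s := by
      simpa using (Complex.ofRealCLM.hasDerivAt (x := s)).const_mul (Complex.I * lam n)
    exact (h1.cexp.mul_const _).const_mul _
  · rw [norm_inner_symm (Φ n) ψ', hψ2]
    simp only [norm_mul, hnorm, Complex.norm_I, one_mul]
    apply le_of_eq
    ring
  · have := (Φ.hasSum_inner_mul_inner ψ h).summable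
    simpa using this

/-! ### The duality pairing -/

variable [CompleteSpace H]

/-- On `D(A^θ)` the factors `lam n ^ (-θ)` and `lam n ^ θ` cancel in Parseval's sum. The right side
is uniformly continuous for the norm of `𝓗_θ`, so `scalePairing` is a genuine extension. -/
theorem scalePairing_eq_inner (hA : A.IsSymm) (hΦ : ∀ n, Φ n ∈ eigSpace A (lam n))
    (hpos : ∀ n, 0 < lam n) (θ : ℝ) {φ ψ : H}
    (hψ : ∀ n, inner ℂ (Φ n) ψ = ((lam n ^ (-θ) : ℝ) : ℂ) * inner ℂ (Φ n) φ) (x : Scale A θ) :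
    scalePairing A θ φ x = inner ℂ ψ (scaleIsometry A θ x) := by
  have hpre : (fun u : PreScale A θ => inner ℂ φ ((show ↥(opPow A θ).domain from u) : H)) =
      fun u => inner ℂ ψ (PreScale.pow A θ u) := by
    ext u
    have h1 := Φ.hasSum_inner_mul_inner φ ((show ↥(opPow A θ).domain from u) : H)
    have h2 := Φ.hasSum_inner_mul_inner ψ (PreScale.pow A θ u)
    refine h1.unique ?_
    convert h2 using 1
    ext n
    have e1 : inner ℂ (Φ n) (PreScale.pow A θ u) = _ := inner_opPow hA θ (hΦ n) u
    rw [e1, ← inner_conj_symm ψ, hψ, map_mul, Complex.conj_ofReal, inner_conj_symm]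
    have e2 : ((lam n ^ (-θ) : ℝ) : ℂ) * ((lam n ^ θ : ℝ) : ℂ) = 1 := by
      rw [← Complex.ofReal_mul, ← Real.rpow_add (hpos n), neg_add_cancel, Real.rpow_zero,
        Complex.ofReal_one]
    linear_combination (-(inner ℂ φ (Φ n) * inner ℂ (Φ n)
      ((show ↥(opPow A θ).domain from u) : H))) * e2
  have hpow : UniformContinuous (PreScale.pow A θ) :=
    (preScaleIsometry A θ).isometry.uniformContinuous
  have huc : UniformContinuous fun u : PreScale A θ => inner ℂ ψ (PreScale.pow A θ u) :=
    (innerSL ℂ ψ).uniformContinuous.comp hpow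
  rw [scalePairing, hpre]
  induction x using UniformSpace.Completion.induction_on with
  | hp =>
    exact isClosed_eq UniformSpace.Completion.continuous_extension
      ((innerSL ℂ ψ).continuous.comp (scaleIsometry A θ).continuous)
  | ih u => rw [UniformSpace.Completion.extension_coe huc, scaleIsometry_coe]

/-! ### Solutions of the Schrödinger equation -/

/-- Testing with `Φ n` gives `g' = i λ_n g` on `(0, T)`, so `e^{-i λ_n s} g(s)` has zero derivative
there. Continuity on `[0, T]` carries the identity to both end points. -/
theorem IsSchrodingerSolution.inner_eq (hA : A.IsSymm) (hΦ : ∀ n, Φ n ∈ eigSpace A (lam n))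
    (hpos : ∀ n, 0 < lam n) {θ T : ℝ} {hT : 0 < T} {y₀ : Scale A θ}
    {y : C(Set.Icc (0 : ℝ) T, Scale A θ)} (hy : IsSchrodingerSolution A θ hT y₀ y)
    (t : Set.Icc (0 : ℝ) T) (n : ℕ) :
    inner ℂ (Φ n) (scaleIsometry A θ (y t)) =
      Complex.exp (Complex.I * lam n * (t : ℝ)) * inner ℂ (Φ n) (scaleIsometry A θ y₀) := by
  set g : ℝ → ℂ := fun s => inner ℂ (Φ n) (scaleIsometry A θ (y (Set.projIcc 0 T hT.le s))) with hg
  have hne : ((lam n ^ (-θ) : ℝ) : ℂ) ≠ 0 := by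
    exact_mod_cast (Real.rpow_pos_of_pos (hpos n) (-θ)).ne'
  have hgc : Continuous g := (innerSL ℂ (Φ n)).continuous.comp
    ((scaleIsometry A θ).continuous.comp (y.continuous.comp continuous_projIcc))
  have hpair : ∀ (a : ℂ) (x : Scale A θ), scalePairing A θ (a • Φ n) x = (starRingEnd ℂ) a *
      (((lam n ^ (-θ) : ℝ) : ℂ) * inner ℂ (Φ n) (scaleIsometry A θ x)) := fun a x => by
    rw [scalePairing_eq_inner hA hΦ hpos θ (ψ := (a * ((lam n ^ (-θ) : ℝ) : ℂ)) • Φ n),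
      inner_smul_left, map_mul, Complex.conj_ofReal, mul_assoc]
    intro m
    rw [inner_smul_right, inner_smul_right]
    rcases eq_or_ne m n with rfl | hmn
    · ring
    · rw [Φ.orthonormal.2 hmn, mul_zero, mul_zero, mul_zero]
  have hpair1 : ∀ x : Scale A θ, scalePairing A θ (Φ n) x =
      ((lam n ^ (-θ) : ℝ) : ℂ) * inner ℂ (Φ n) (scaleIsometry A θ x) := fun x => by
    simpa using hpair 1 x
  have hgd : ∀ s ∈ Set.Ioo 0 T, HasDerivAt g (Complex.I * lam n * g s) s := fun s hs => by
    obtain ⟨hdom, hAΦ⟩ := hΦ n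
    have h := hy.2 (Φ n) (mem_smoothVectors_of_mem_eigSpace (hΦ n)) s hs
    simp only [hAΦ, hpair, hpair1, Complex.conj_ofReal] at h
    have h' := h.const_mul (((lam n ^ (-θ) : ℝ) : ℂ)⁻¹)
    simp only [inv_mul_cancel_left₀ hne] at h'
    refine h'.congr_deriv ?_
    field_simp
    rfl
  have hexp : ∀ s : ℝ, HasDerivAt (fun s : ℝ => Complex.exp (-(Complex.I * lam n * s)))
      (Complex.exp (-(Complex.I * lam n * s)) * -(Complex.I * lam n)) s := fun s => by
    have h1 : HasDerivAt (fun s : ℝ => -(Complex.I * lam n * (s : ℂ))) (-(Complex.I * lam n)) s := by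
      simpa using ((Complex.ofRealCLM.hasDerivAt (x := s)).const_mul (Complex.I * lam n)).fun_neg
    exact h1.cexp
  have hconst := intervalIntegral.integral_eq_sub_of_hasDeriv_right_of_le
    (f := fun s : ℝ => Complex.exp (-(Complex.I * lam n * s)) * g s) (f' := fun _ => 0) t.2.1
    (Continuous.continuousOn (by fun_prop)) (fun s hs => by
      have h := (hexp s).mul (hgd s ⟨hs.1, hs.2.trans_le t.2.2⟩)
      refine (h.congr_deriv ?_).hasDerivWithinAt
      ring) intervalIntegrable_const
  simp only [intervalIntegral.integral_zero, Complex.ofReal_zero, mul_zero, neg_zero,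
    Complex.exp_zero, one_mul] at hconst
  have h0 : g 0 = inner ℂ (Φ n) (scaleIsometry A θ y₀) := by
    simp only [hg, Set.projIcc_left, hy.1]
  have ht : g t = inner ℂ (Φ n) (scaleIsometry A θ (y t)) := by
    simp only [hg, Set.projIcc_val]
  rw [h0, ht] at hconst
  rw [← sub_eq_zero.1 hconst.symm, ← mul_assoc, ← Complex.exp_add, add_neg_cancel,
    Complex.exp_zero, one_mul]

theorem IsSchrodingerSolution.unique (hA : A.IsSymm) (hΦ : ∀ n, Φ n ∈ eigSpace A (lam n))
    (hpos : ∀ n, 0 < lam n) {θ T : ℝ} {hT : 0 < T} {y₀ : Scale A θ}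
    {y z : C(Set.Icc (0 : ℝ) T, Scale A θ)} (hy : IsSchrodingerSolution A θ hT y₀ y)
    (hz : IsSchrodingerSolution A θ hT y₀ z) : z = y := by
  ext t : 1
  refine (scaleIsometry A θ).injective (Φ.ext_inner fun n => ?_)
  rw [hy.inner_eq hA hΦ hpos, hz.inner_eq hA hΦ hpos]

/-- The unitary orbit of `A^θ y₀` in `H` is pulled back to `𝓗_θ`; pairings with `φ` and `A φ` become
inner products with `A^(-θ) φ` and `A^(-θ) A φ`. -/
theorem exists_isSchrodingerSolution (hA : A.IsSymm) (hΦ : ∀ n, Φ n ∈ eigSpace A (lam n))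
    (hmono : Monotone lam) (hpos : ∀ n, 0 < lam n) (θ : ℝ) {T : ℝ} (hT : 0 < T)
    (y₀ : Scale A θ) :
    ∃ y : C(Set.Icc (0 : ℝ) T, Scale A θ), IsSchrodingerSolution A θ hT y₀ y := by
  obtain ⟨w, hwc, hw⟩ := exists_unitary_orbit Φ lam (scaleIsometry A θ y₀)
  let e := LinearIsometryEquiv.ofSurjective (scaleIsometry A θ)
    (scaleIsometry_surjective hA θ hΦ hpos)
  have he : ∀ x, scaleIsometry A θ (e.symm x) = x := fun x => e.apply_symm_apply x
  refine ⟨⟨fun t => e.symm (w t), e.symm.continuous.comp (hwc.comp continuous_subtype_val)⟩,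
    ?_, fun φ hφ t ht => ?_⟩
  · refine (scaleIsometry A θ).injective (Φ.ext_inner fun n => ?_)
    change inner ℂ (Φ n) (scaleIsometry A θ (e.symm (w 0))) = _
    rw [he, hw]
    simp
  · obtain ⟨ψ, hψ⟩ := exists_inner_eq_rpow_neg_mul hA hΦ hmono hpos θ hφ
    obtain ⟨ψ', hψ'⟩ := exists_inner_eq_rpow_neg_mul hA hΦ hmono hpos θ (apply_mem_smoothVectors hφ)
    have hψψ' : ∀ n, inner ℂ (Φ n) ψ' = (lam n : ℂ) * inner ℂ (Φ n) ψ := fun n => by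
      rw [hψ', hψ, hA.inner_apply_of_mem_eigSpace (hΦ n)]
      ring
    have hproj : ∀ s ∈ Set.Ioo 0 T, ((Set.projIcc 0 T hT.le s : Set.Icc 0 T) : ℝ) = s :=
      fun s hs => by rw [Set.projIcc_of_mem hT.le (Set.Ioo_subset_Icc_self hs)]
    simp only [scalePairing_eq_inner hA hΦ hpos θ hψ, scalePairing_eq_inner hA hΦ hpos θ hψ',
      ContinuousMap.coe_mk, he, hproj t ht]
    refine (hasDerivAt_inner_orbit hw hψψ' t).congr_of_eventuallyEq ?_
    filter_upwards [Ioo_mem_nhds ht.1 ht.2] with s hs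
    rw [hproj s hs]

end Evolution

/-! ### The clamped operator -/

section ClampedOperator

/-- Indicators of the disjoint intervals `(ℓ/(n+2), ℓ/(n+1))` are orthogonal and nonzero. -/
theorem not_finiteDimensional_weightedL2 {ℓ : ℝ} {ρ : ℝ → ℝ} (hℓ : 0 < ℓ)
    (hρ : ContinuousOn ρ (Set.Icc 0 ℓ)) (hpos : ∀ x ∈ Set.Icc 0 ℓ, 0 < ρ x) :
    ¬ FiniteDimensional ℂ (WeightedL2 ℓ ρ) := by
  intro hfd
  have := isFiniteMeasure_weightMeasure hρ
  let s : ℕ → Set ℝ := fun n => Set.Ioo (ℓ / (n + 2)) (ℓ / (n + 1))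
  have hs : ∀ n, MeasurableSet (s n) := fun n => measurableSet_Ioo
  have hdisj : ∀ m n, m < n → Disjoint (s m) (s n) := fun m n hmn => by
    rw [Set.disjoint_left]
    intro x hx hx'
    have h1 : ℓ / ((n : ℝ) + 1) ≤ ℓ / ((m : ℝ) + 2) := by
      have : (m : ℝ) + 1 ≤ n := by exact_mod_cast hmn
      gcongr ℓ / ?_
      linarith
    exact absurd (hx.1.trans hx'.2) (not_lt.2 h1)
  have hdisj' : Pairwise fun m n => Disjoint (s m) (s n) := fun m n hmn => by
    rcases lt_or_gt_of_ne hmn with h | h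
    · exact hdisj m n h
    · exact (hdisj n m h).symm
  let v : ℕ → WeightedL2 ℓ ρ := fun n =>
    indicatorConstLp 2 (hs n) (measure_ne_top (weightMeasure ℓ ρ) _) (1 : ℂ)
  have hmeas : ∀ n, weightMeasure ℓ ρ (s n) ≠ 0 := fun n h0 => by
    have h1 := absolutelyContinuous_weightMeasure hρ hpos h0
    have hsub : s n ⊆ Set.Ioo 0 ℓ := by
      refine Set.Ioo_subset_Ioo (by positivity) (div_le_self hℓ.le ?_)
      linarith [(Nat.cast_nonneg n : (0 : ℝ) ≤ n)]
    rw [Measure.restrict_apply (hs n), Set.inter_eq_self_of_subset_left hsub, Real.volume_Ioo,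
      ENNReal.ofReal_eq_zero, sub_nonpos] at h1
    refine absurd h1 (not_le.2 ?_)
    gcongr
    norm_num
  have hli : LinearIndependent ℂ v := by
    refine linearIndependent_of_ne_zero_of_inner_eq_zero (fun n h0 => ?_) fun m n hmn => ?_
    · have h1 : ‖v n‖ = 0 := by rw [h0, norm_zero]
      rw [norm_indicatorConstLp (by norm_num) (by norm_num), norm_one, one_mul,
        Real.rpow_eq_zero measureReal_nonneg (by norm_num)] at h1
      exact hmeas n ((measureReal_eq_zero_iff).1 h1)
    · change inner ℂ (v m) (v n) = 0
      simp only [v]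
      rw [L2.inner_indicatorConstLp_one]
      refine (integral_congr_ae ?_).trans (integral_zero _ _)
      have hcoe : v n =ᵐ[weightMeasure ℓ ρ] (s n).indicator fun _ => 1 := indicatorConstLp_coeFn
      filter_upwards [ae_restrict_of_ae hcoe, ae_restrict_mem (hs m)] with x h1 h2
      refine h1.trans ?_
      exact Set.indicator_of_notMem (Set.disjoint_left.1 (hdisj' hmn) h2) _
  have := hli.finite
  exact not_finite ℕ

variable {ℓ : ℝ} {ρ σ q : ℝ → ℝ}

/-- The clamped operator has a compact, symmetric, nonnegative inverse. -/
theorem exists_inverse_clampedOperator (hℓ : 0 < ℓ)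
    (hρ : MemSobolev ℓ 2 ρ) (hσ : MemSobolev ℓ 2 σ) (hq : MemSobolev ℓ 1 q)
    (hρ₀ : ∃ ρ₀ > 0, ∀ x ∈ Set.Icc 0 ℓ, ρ₀ ≤ ρ x)
    (hσ₀ : ∃ σ₀ > 0, ∀ x ∈ Set.Icc 0 ℓ, σ₀ ≤ σ x)
    (hq₀ : ∀ x ∈ Set.Icc 0 ℓ, 0 ≤ q x) :
    ∃ K : WeightedL2 ℓ ρ →L[ℂ] WeightedL2 ℓ ρ, IsCompactOperator K ∧ K.IsSymmetric ∧
      (∀ f, 0 ≤ (inner ℂ f (K f)).re) ∧ (∀ f, K f = 0 → f = 0) ∧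
      ∀ u f, (u, f) ∈ (clampedOperator ℓ ρ σ q).graph ↔ u = K f := by
  obtain ⟨ρ₀, hρ₀, hρle⟩ := hρ₀
  obtain ⟨σ₀, hσ₀, hσle⟩ := hσ₀
  obtain ⟨Dρ, rfl, hDρ⟩ := hρ
  obtain ⟨Dσ, rfl, hDσ⟩ := hσ
  obtain ⟨Dq, rfl, hDq⟩ := hq
  have hρc := (hDρ.1 0 (by norm_num)).continuousOn_real hℓ.le
  have hσc := (hDσ.1 0 (by norm_num)).continuousOn_real hℓ.le
  have hqc := (hDq.1 0 (by norm_num)).continuousOn_real hℓ.le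
  have hρpos : ∀ x ∈ Set.Icc 0 ℓ, 0 < Dρ 0 x := fun x hx => hρ₀.trans_le (hρle x hx)
  have hσpos : ∀ x ∈ Set.Icc 0 ℓ, 0 < Dσ 0 x := fun x hx => hσ₀.trans_le (hσle x hx)
  have hσ2 : HasH2Deriv ℓ (fun x => (Dσ 0 x : ℂ)) (fun x => (Dσ 1 x : ℂ)) (fun x => (Dσ 2 x : ℂ)) :=
    ⟨(hDσ.1 0 (by norm_num)).ofReal, (hDσ.1 1 (by norm_num)).ofReal,
      (hDσ.2 2 le_rfl).ofReal⟩
  obtain ⟨K, hKc, hKs, hKn, hK⟩ := exists_compact_solution_operator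
    (energyOp hℓ.le hσc hqc) (isSymmetric_energyOp hℓ.le hσc hqc) hσ₀
    (le_re_inner_energyOp hℓ.le hσc hqc hσle hq₀) (clampedSpace hℓ.le)
    (weightedVolterraSq hℓ.le hρc) (isCompactOperator_weightedVolterraSq hℓ.le hρc)
  have hmem : ∀ f, (K f, f) ∈ clampedGraph ℓ (Dρ 0) (Dσ 0) (Dq 0) := fun f => by
    obtain ⟨w, hw, hKf, hweak⟩ := hK f
    rw [hKf]
    exact mem_clampedGraph_of_weak hℓ hρc hρ₀ hρle hσ2 hσpos hσc (hDq.1 0 (by norm_num)).ofReal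
      (hDq.2 1 le_rfl).ofReal hqc hw hweak
  refine ⟨K, hKc, hKs, hKn, fun f hf => ?_, fun u f => ?_⟩
  · have h := hmem f
    rw [hf] at h
    exact clampedGraph_snd_eq_zero hℓ hρc hρpos h
  · rw [clampedOperator, Submodule.toLinearPMap_graph_eq _ (fun x hx hx0 => by
      obtain ⟨x1, x2⟩ := x
      simp only at hx0
      subst hx0
      exact clampedGraph_snd_eq_zero hℓ hρc hρpos hx)]
    constructor
    · intro h
      -- The difference `(u - K f, 0)` lies in the graph, and the kernel is trivial.
      have h2 := Submodule.sub_mem _ h (hmem f)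
      rw [Prod.mk_sub_mk, sub_self] at h2
      exact sub_eq_zero.1
        (clampedGraph_fst_eq_zero hℓ hρc hρpos hσc hσ₀ hσle hqc hq₀ h2)
    · rintro rfl
      exact hmem f

/-! ### Operators whose graph is the transposed graph of a bounded operator -/

section Inverse

variable {H : Type*} [NormedAddCommGroup H] [InnerProductSpace ℂ H] {A : H →ₗ.[ℂ] H}
  {K : H →L[ℂ] H}

theorem isSymm_of_graph_eq (hK : K.IsSymmetric) (hA : ∀ u f, (u, f) ∈ A.graph ↔ u = K f) :
    A.IsSymm := by
  intro u v
  have hu := (hA _ _).1 (A.mem_graph u)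
  have hv := (hA _ _).1 (A.mem_graph v)
  rw [hu, hv]
  exact (hK _ _).symm

theorem mem_eigSpace_of_graph_eq (hA : ∀ u f, (u, f) ∈ A.graph ↔ u = K f) {r : ℝ} (hr : r ≠ 0)
    {e : H} (he : K e = ((r : ℂ)⁻¹) • e) : e ∈ eigSpace A r := by
  have h : (e, (r : ℂ) • e) ∈ A.graph := by
    rw [hA, map_smul, he, smul_inv_smul₀]
    exact_mod_cast hr
  obtain ⟨y, hy1, hy2⟩ := A.mem_graph_iff.1 h
  simp only at hy1 hy2
  subst hy1
  exact ⟨y.2, hy2⟩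

end Inverse

end ClampedOperator

end

/-! ### Well-posedness of the clamped Schrödinger problem -/

theorem proposition2p2 (ℓ T : ℝ) (hℓ : 0 < ℓ) (hT : 0 < T) (ρ σ q : ℝ → ℝ)
    (hρ : MemSobolev ℓ 2 ρ) (hσ : MemSobolev ℓ 2 σ) (hq : MemSobolev ℓ 1 q)
    (hρ₀ : ∃ ρ₀ > 0, ∀ x ∈ Set.Icc 0 ℓ, ρ₀ ≤ ρ x)
    (hσ₀ : ∃ σ₀ > 0, ∀ x ∈ Set.Icc 0 ℓ, σ₀ ≤ σ x)
    (hq₀ : ∀ x ∈ Set.Icc 0 ℓ, 0 ≤ q x) :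
    -- the operator has an orthonormal basis of eigenfunctions
    (∃ (lam : ℕ → ℝ) (Φ : HilbertBasis ℕ ℂ (WeightedL2 ℓ ρ)),
      IsEigenbasis (clampedOperator ℓ ρ σ q) lam Φ ∧ 0 < lam 0 ∧
        Filter.Tendsto lam Filter.atTop Filter.atTop) ∧
    ∀ (θ : ℝ) (y₀ : Scale (clampedOperator ℓ ρ σ q) θ),
      ∃ y : C(Set.Icc (0 : ℝ) T, Scale (clampedOperator ℓ ρ σ q) θ),
        -- existence and uniqueness
        IsSchrodingerSolution (clampedOperator ℓ ρ σ q) θ hT y₀ y ∧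
        (∀ z : C(Set.Icc (0 : ℝ) T, Scale (clampedOperator ℓ ρ σ q) θ),
          IsSchrodingerSolution (clampedOperator ℓ ρ σ q) θ hT y₀ z → z = y) ∧
        -- the Fourier series
        (∀ (lam : ℕ → ℝ) (Φ : HilbertBasis ℕ ℂ (WeightedL2 ℓ ρ)),
          IsEigenbasis (clampedOperator ℓ ρ σ q) lam Φ →
          ∃ hΦ : ∀ n, Φ n ∈ (opPow (clampedOperator ℓ ρ σ q) θ).domain,
            (∃ c : ℕ → ℂ,
              HasSum (fun n => c n • toScale (clampedOperator ℓ ρ σ q) θ (Φ n) (hΦ n)) y₀) ∧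
            ∀ c : ℕ → ℂ,
              HasSum (fun n => c n • toScale (clampedOperator ℓ ρ σ q) θ (Φ n) (hΦ n)) y₀ →
              ∀ t : Set.Icc (0 : ℝ) T,
                HasSum (fun n => (c n * Complex.exp (Complex.I * lam n * (t : ℝ))) •
                  toScale (clampedOperator ℓ ρ σ q) θ (Φ n) (hΦ n)) (y t)) ∧
        -- conservation of the energy
        ∀ t : Set.Icc (0 : ℝ) T, ‖y t‖ ^ 2 = ‖y₀‖ ^ 2 := by
  obtain ⟨K, hKc, hKs, hKn, hKi, hKg⟩ :=
    exists_inverse_clampedOperator hℓ hρ hσ hq hρ₀ hσ₀ hq₀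
  have hdim : ¬ FiniteDimensional ℂ (WeightedL2 ℓ ρ) := by
    obtain ⟨ρ₀, hρ₀, hρle⟩ := hρ₀
    obtain ⟨D, rfl, hD⟩ := hρ
    exact not_finiteDimensional_weightedL2 hℓ ((hD.1 0 (by norm_num)).continuousOn_real hℓ.le)
      fun x hx => hρ₀.trans_le (hρle x hx)
  obtain ⟨lam₀, Φ₀, hmono, hpos, htend, hKΦ⟩ := exists_eigenbasis_of_compact hKc hKs hKn hKi hdim
  have hA : (clampedOperator ℓ ρ σ q).IsSymm := isSymm_of_graph_eq hKs hKg
  have hΦ₀ : ∀ n, Φ₀ n ∈ eigSpace (clampedOperator ℓ ρ σ q) (lam₀ n) := fun n =>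
    mem_eigSpace_of_graph_eq hKg (hpos n).ne' (hKΦ n)
  refine ⟨⟨lam₀, Φ₀, ⟨hmono, hΦ₀⟩, hpos 0, htend⟩, fun θ y₀ => ?_⟩
  obtain ⟨y, hy⟩ := exists_isSchrodingerSolution hA hΦ₀ hmono hpos θ hT y₀
  refine ⟨y, hy, fun z hz => hy.unique hA hΦ₀ hpos hz, fun lam Φ hΦ => ?_, fun t => ?_⟩
  -- The eigenbasis is now arbitrary, so its eigenvalues must first be recognised among the positive
  -- `lam₀ m`.
  · have hlam : ∀ n, 0 < lam n := fun n => by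
      obtain ⟨m, hm⟩ := eigenvalue_mem_range hA hΦ₀ (hΦ.2 n) (Φ.orthonormal.ne_zero n)
      exact hm ▸ hpos m
    have hdom : ∀ n, Φ n ∈ (opPow (clampedOperator ℓ ρ σ q) θ).domain := fun n =>
      mem_opPow_domain_of_mem_eigSpace hA θ (hΦ.2 n)
    refine ⟨hdom, ⟨fun n => inner ℂ (Φ n) (scaleIsometry _ θ y₀) / ((lam n ^ θ : ℝ) : ℂ), ?_⟩,
      fun c hc t => ?_⟩
    · rw [hasSum_smul_toScale_iff hA θ hΦ.2 hlam]
      intro n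
      refine div_mul_cancel₀ _ ?_
      exact_mod_cast (Real.rpow_pos_of_pos (hlam n) θ).ne'
    · rw [hasSum_smul_toScale_iff hA θ hΦ.2 hlam] at hc ⊢
      intro n
      rw [hy.inner_eq hA hΦ.2 hlam, ← hc n]
      ring
  · rw [← (scaleIsometry _ θ).norm_map, ← (scaleIsometry _ θ).norm_map y₀]
    congr 1
    refine Φ₀.norm_eq_of_norm_inner_eq fun n => ?_
    rw [hy.inner_eq hA hΦ₀ hpos, norm_mul, norm_exp_I_mul_ofReal_mul_ofReal, one_mul]
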